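/- Let $(q_n)_{n\ge 1}$ be a lacunary sequence of real numbers, i.e. there is $C>1$ with $q_{n+1}/q_n\ge C$ for all $n\ge 1$. Let $\gamma\in[0,1]$ and let $\psi:\mathbb R\to(0,1)$ satisfy $\psi(q_n)\le \tfrac12$ for all $n\ge1$. Let $\mu$ be a Borel probability measure on $\mathbb R$ supported on a set $E\subset[0,1]$ (that is, $\mu(\mathbb R\setminus E)=0$), with Fourier transform $\widehat\mu(t)=\int e^{-2\pi i t x}\,d\mu(x)$. Suppose that there exists $A>2$ such that $$\widehat\mu(t)=O\big((\log|t|)^{-A}\big)\quad\text{as }|t|\to\infty .$$ For $x\in\mathbb R$ and $N\ge 1$ put $$R(x,N)=\#\{1\le n\le N:\ \|q_nx-\gamma\|\le\psi(q_n)\},\qquad \Psi(N)=\sum_{n=1}^N\psi(q_n),$$ where $\|\alpha\|=\min_{m\in\mathbb Z}|\alpha-m|$. Then for every $\varepsilon>0$, for $\mu$-almost every $x\in E$, $$R(x,N)=2\Psi(N)+O\Big(\Psi(N)^{1/2}\big(\log(\Psi(N)+2)\big)^{3/2+\varepsilon}\Big)\quad\text{for all }N\ge1,$$ where the implied constant does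 not depend on $N$ (it may depend on $x$, $\varepsilon$, $\mu$, $\gamma$, $\psi$ and the sequence $(q_n)$). -/

import Mathlib

open Filter MeasureTheory

/-- The distance `‖α‖ = min {|α - m| : m ∈ ℤ}` from `α` to the nearest integer. -/
noncomputable def distNearestInt (α : ℝ) : ℝ := |α - round α|

theorem distNearestInt_isLeast (α : ℝ) :
    IsLeast (Set.range fun m : ℤ => |α - m|) (distNearestInt α) := by
  refine ⟨⟨round α, rfl⟩, ?_⟩
  rintro _ ⟨m, rfl⟩
  exact round_le α m

/-- The Hadamard gap condition for the real sequence `q 1, q 2, …` (the value `q 0` plays no role).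
It forces `q n ≠ 0` for `n ≥ 1`, since a quotient by zero is zero. -/
def IsLacunary (q : ℕ → ℝ) : Prop :=
  ∃ C : ℝ, 1 < C ∧ ∀ n : ℕ, 1 ≤ n → C ≤ q (n + 1) / q n

/-- The Fourier transform `∫ e(-t x) dμ(x)` of a measure on the line, `e(x) = exp (2 π i x)`. -/
noncomputable def measureFourier (μ : Measure ℝ) (t : ℝ) : ℂ :=
  ∫ x, Complex.exp (2 * Real.pi * Complex.I * ((-(t * x) : ℝ) : ℂ)) ∂μ

/-- The counting function `#{1 ≤ n ≤ N : ‖q n * x - γ‖ ≤ ψ (q n)}`. -/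
noncomputable def countR (q : ℕ → ℝ) (γ : ℝ) (ψ : ℝ → ℝ) (x : ℝ) (N : ℕ) : ℕ :=
  Set.ncard {n : ℕ | 1 ≤ n ∧ n ≤ N ∧ distNearestInt (q n * x - γ) ≤ ψ (q n)}

/-- The partial sums `∑_{n=1}^N ψ (q n)`. -/
noncomputable def sumPsi (q : ℕ → ℝ) (ψ : ℝ → ℝ) (N : ℕ) : ℝ :=
  ∑ n ∈ Finset.Icc 1 N, ψ (q n)

/-! The events `hitSet q γ ψ n` are nearly pairwise independent under `μ`, each of measure close to
`2 * ψ (q n)`, so the counting function obeys a quantitative strong law.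

To see this, the indicator of an arc is compared with cosine polynomials of degree `K` whose
coefficients are at most `1 / k` and whose mean is off by at most `2 / √(K + 1)`. Integration
against `μ` leaves values of the Fourier transform at `k * q n`, or at `l * q n ± k * q m` for a
pair. Lacunarity makes `log |q n|` grow at least linearly in `n`, so these values are `O(n ^ (-A))`.
With degrees polynomial in `n` the coefficient sums cost only logarithms, and `A > 2` leaves errors
`n ^ (-(2 + δ))` (`exists_hitSet_bounds`). Summing such an error over all `m < n` costs a factor
`n`; what remains is summable, so the variance over any block is at most a constant times its mass
`∑ (ψ (q n) + φ n)` with `φ` summable (`exists_variance_le`).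

If `∑ ψ (q n)` converges, Borel–Cantelli bounds the count. Otherwise time is reparametrised so that
mass grows linearly, and dyadic chaining (`ae_exists_abs_sub_le`) turns the variance bound into an
almost sure one. In the square, one logarithm comes from the number of dyadic scales in the
expectation, one from Cauchy–Schwarz along the chain, and `1 + 2 * ε` from summability over `r`;
hence the exponent `3 / 2 + ε`. Monotonicity of the count fills the gaps. -/

/-! ### Distance to the nearest integer. -/

theorem distNearestInt_nonneg (x : ℝ) : 0 ≤ distNearestInt x := abs_nonneg _

theorem distNearestInt_le_half (x : ℝ) : distNearestInt x ≤ 1 / 2 := abs_sub_round x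

theorem measurable_distNearestInt : Measurable distNearestInt := by
  have h : distNearestInt = fun x : ℝ => |x - (⌊x + 1 / 2⌋ : ℤ)| := by
    funext x
    rw [distNearestInt, round_eq]
  rw [h]
  have : Measurable fun x : ℝ => ((⌊x + 1 / 2⌋ : ℤ) : ℝ) :=
    (measurable_from_top (f := fun n : ℤ => (n : ℝ))).comp
      (Int.measurable_floor.comp (measurable_id.add_const _))
  fun_prop

theorem cos_two_pi_nat_mul_distNearestInt (k : ℕ) (x : ℝ) :
    Real.cos (2 * Real.pi * k * distNearestInt x) = Real.cos (2 * Real.pi * k * x) := by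
  have h : Real.cos (2 * Real.pi * k * (x - round x)) = Real.cos (2 * Real.pi * k * x) := by
    have := Real.cos_sub_int_mul_two_pi (2 * Real.pi * k * x) (k * round x)
    rw [← this]
    congr 1
    push_cast
    ring
  rw [← h, distNearestInt]
  rcases abs_choice (x - round x) with h' | h' <;> rw [h']
  rw [mul_neg, Real.cos_neg]

/-- The complement of a closed arc around `0` lies in a closed arc around `1 / 2`. -/
theorem distNearestInt_sub_half_le {x a : ℝ} (h : a < distNearestInt x) :
    distNearestInt (x - 1 / 2) ≤ 1 / 2 - a := by
  have hh := abs_sub_round x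
  have h2 : a < |x - round x| := h
  rcases le_total 0 (x - round x) with h0 | h0
  · rw [abs_of_nonneg h0] at hh h2
    refine ((distNearestInt_isLeast (x - 1 / 2)).2 ⟨round x, rfl⟩).trans ?_
    change |x - 1 / 2 - (round x : ℝ)| ≤ _
    rw [abs_of_nonpos] <;> linarith
  · rw [abs_of_nonpos h0] at hh h2
    refine ((distNearestInt_isLeast (x - 1 / 2)).2 ⟨round x - 1, rfl⟩).trans ?_
    change |x - 1 / 2 - ((round x - 1 : ℤ) : ℝ)| ≤ _
    push_cast
    rw [abs_of_nonneg] <;> linarith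

/-! ### Cosine polynomials above and below the indicator of an arc. -/

/-- This is the Fourier series of the second Bernoulli polynomial on `[0, 1]`, extended to `[-1, 1]`
by evenness. The term `n = 0` vanishes because `1 / 0 = 0`. -/
theorem hasSum_inv_sq_mul_cos {x : ℝ} (hx : |x| ≤ 1) :
    HasSum (fun n : ℕ => 1 / (n : ℝ) ^ 2 * Real.cos (2 * Real.pi * n * x))
      (Real.pi ^ 2 * (x ^ 2 - |x| + 1 / 6)) := by
  have h := hasSum_one_div_nat_pow_mul_cos (k := 1) one_ne_zero (x := |x|) ⟨abs_nonneg x, hx⟩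
  have hB : Polynomial.eval |x| (Polynomial.map (algebraMap ℚ ℝ) (Polynomial.bernoulli 2)) =
      x ^ 2 - |x| + 1 / 6 := by
    simp only [Polynomial.bernoulli, Finset.sum_range_succ, Finset.range_zero, Finset.sum_empty,
      bernoulli_two, bernoulli_one, bernoulli_zero]
    simp
    ring
  rw [mul_one, hB] at h
  convert! h using 1
  · funext n
    congr 1
    rcases abs_choice x with h' | h' <;> rw [h']
    rw [mul_neg, Real.cos_neg]
  · rw [Nat.factorial_two]
    push_cast
    ring

/-- Average the preceding series at `y + s` and `y - s`; since `|y + s| + |y - s| = 2 * max y s`, a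
kink appears at `s`. A difference of two such kinks is a ramp. -/
theorem hasSum_inv_sq_mul_cos_mul_cos {y s : ℝ} (hy : y ∈ Set.Icc (0 : ℝ) (1 / 2))
    (hs : s ∈ Set.Icc (0 : ℝ) (1 / 2)) :
    HasSum (fun n : ℕ => 1 / (n : ℝ) ^ 2 *
        (Real.cos (2 * Real.pi * n * y) * Real.cos (2 * Real.pi * n * s)))
      (Real.pi ^ 2 * (y ^ 2 + s ^ 2 - max y s + 1 / 6)) := by
  obtain ⟨hy0, hy1⟩ := hy
  obtain ⟨hs0, hs1⟩ := hs
  have h1 := hasSum_inv_sq_mul_cos (x := y + s) (by rw [abs_le]; constructor <;> linarith)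
  have h2 := hasSum_inv_sq_mul_cos (x := y - s) (by rw [abs_le]; constructor <;> linarith)
  convert! (h1.add h2).mul_left (1 / 2) using 1
  · funext n
    rw [mul_add (2 * Real.pi * n), mul_sub (2 * Real.pi * n), Real.cos_add, Real.cos_sub]
    ring
  · rw [abs_of_nonneg (by linarith : 0 ≤ y + s)]
    rcases le_total y s with h | h
    · rw [max_eq_right h, abs_of_nonpos (by linarith)]; ring
    · rw [max_eq_left h, abs_of_nonneg (by linarith)]; ring

/-- The cosine coefficients of the trapezoid equal to `1` on `[0, a]` and to `0` beyond `b`. -/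
noncomputable def trapezoidCoeff (a b : ℝ) (k : ℕ) : ℝ :=
  (Real.cos (2 * Real.pi * k * a) - Real.cos (2 * Real.pi * k * b)) /
    (Real.pi ^ 2 * k ^ 2 * (b - a))

/-- Subtracting the kink series at `a` and `b` cancels the quadratic terms in `distNearestInt x`.
The quotient on the right is the trapezoid and `a + b` is its mean. -/
theorem hasSum_trapezoid {a b : ℝ} (ha : 0 ≤ a) (hab : a < b) (hb : b ≤ 1 / 2) (x : ℝ) :
    HasSum (fun k : ℕ => trapezoidCoeff a b k * Real.cos (2 * Real.pi * k * x))
      ((max (distNearestInt x) b - max (distNearestInt x) a) / (b - a) - (a + b)) := by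
  have hy : distNearestInt x ∈ Set.Icc (0 : ℝ) (1 / 2) :=
    ⟨distNearestInt_nonneg x, distNearestInt_le_half x⟩
  have h1 := hasSum_inv_sq_mul_cos_mul_cos hy (s := a) ⟨ha, by linarith⟩
  have h2 := hasSum_inv_sq_mul_cos_mul_cos hy (s := b) ⟨by linarith, hb⟩
  have hpi := Real.pi_pos.ne'
  have hba : b - a ≠ 0 := by linarith
  convert! (h1.sub h2).mul_left (1 / (Real.pi ^ 2 * (b - a))) using 1
  · funext k
    rw [trapezoidCoeff, cos_two_pi_nat_mul_distNearestInt]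
    rcases Nat.eq_zero_or_pos k with rfl | hk
    · simp
    · have : (k : ℝ) ≠ 0 := by positivity
      field_simp
  · field_simp
    ring

/-- The Lipschitz bound for the cosine cancels the factor `b - a`, so a steep ramp does not enlarge
the coefficients. The quadratic bound that follows does depend on the slope and serves only for the
tail. -/
theorem abs_trapezoidCoeff_le_inv {a b : ℝ} (hab : a < b) {k : ℕ} (hk : 1 ≤ k) :
    |trapezoidCoeff a b k| ≤ 1 / k := by
  have hk' : (0 : ℝ) < k := by exact_mod_cast hk
  have hba : 0 < b - a := by linarith
  have hpi := Real.pi_pos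
  rw [trapezoidCoeff, abs_div, abs_of_pos (by positivity : 0 < Real.pi ^ 2 * k ^ 2 * (b - a)),
    div_le_div_iff₀ (by positivity) hk']
  have h := Real.abs_cos_sub_cos_le (2 * Real.pi * k * a) (2 * Real.pi * k * b)
  have h' : |2 * Real.pi * k * a - 2 * Real.pi * k * b| = 2 * Real.pi * k * (b - a) := by
    rw [abs_sub_comm, abs_of_nonneg] <;> nlinarith [mul_pos (mul_pos hpi hk') hba]
  rw [h'] at h
  have h3 := Real.pi_gt_three
  have : 2 * Real.pi ≤ Real.pi ^ 2 := by nlinarith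
  calc _ ≤ 2 * Real.pi * k * (b - a) * k := by gcongr
    _ = (2 * Real.pi) * (k ^ 2 * (b - a)) := by ring
    _ ≤ Real.pi ^ 2 * (k ^ 2 * (b - a)) := by gcongr
    _ = _ := by ring

theorem abs_trapezoidCoeff_le_inv_sq {a b : ℝ} (hab : a < b) (k : ℕ) :
    |trapezoidCoeff a b k| ≤ 1 / (4 * (b - a)) * ((k : ℝ) ^ 2)⁻¹ := by
  rcases Nat.eq_zero_or_pos k with rfl | hk
  · simp [trapezoidCoeff]
  have hk' : (0 : ℝ) < k := by exact_mod_cast hk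
  have hba : 0 < b - a := by linarith
  have hpi := Real.pi_pos
  have h3 := Real.pi_gt_three
  have h8 : 8 ≤ Real.pi ^ 2 := by nlinarith
  have hn : |Real.cos (2 * Real.pi * k * a) - Real.cos (2 * Real.pi * k * b)| ≤ 2 := by
    rw [abs_le]
    constructor <;>
      linarith [Real.neg_one_le_cos (2 * Real.pi * k * a), Real.cos_le_one (2 * Real.pi * k * a),
        Real.neg_one_le_cos (2 * Real.pi * k * b), Real.cos_le_one (2 * Real.pi * k * b)]
  rw [trapezoidCoeff, abs_div, abs_of_pos (by positivity : 0 < Real.pi ^ 2 * k ^ 2 * (b - a))]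
  calc _ ≤ 2 / (8 * k ^ 2 * (b - a)) := by gcongr
    _ = _ := by field_simp; norm_num

theorem trapezoid_tail_le {a b : ℝ} (ha : 0 ≤ a) (hab : a < b) (hb : b ≤ 1 / 2) (K : ℕ) (x : ℝ) :
    (max (distNearestInt x) b - max (distNearestInt x) a) / (b - a) - (a + b) -
      ∑ k ∈ Finset.Icc 1 K, trapezoidCoeff a b k * Real.cos (2 * Real.pi * k * x) ≤
      1 / (2 * (b - a) * (K + 1)) := by
  have hba : 0 < b - a := by linarith
  have h := (hasSum_trapezoid ha hab hb x).tendsto_sum_nat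
  have h' := h.sub_const
    (∑ k ∈ Finset.Icc 1 K, trapezoidCoeff a b k * Real.cos (2 * Real.pi * k * x))
  refine le_of_tendsto h' ?_
  filter_upwards [eventually_ge_atTop (K + 1)] with n hn
  have hsplit : Finset.range n = {0} ∪ Finset.Icc 1 K ∪ Finset.Ioo K n := by
    ext i; simp; omega
  have hd1 : Disjoint ({0} : Finset ℕ) (Finset.Icc 1 K) := by simp
  have hd2 : Disjoint (({0} : Finset ℕ) ∪ Finset.Icc 1 K) (Finset.Ioo K n) := by
    rw [Finset.disjoint_left]; intro i; simp; omega
  rw [hsplit, Finset.sum_union hd2, Finset.sum_union hd1]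
  have h0 : trapezoidCoeff a b 0 = 0 := by simp [trapezoidCoeff]
  rw [Finset.sum_singleton, h0, zero_mul, zero_add, add_sub_cancel_left]
  calc _ ≤ ∑ k ∈ Finset.Ioo K n, 1 / (4 * (b - a)) * ((k : ℝ) ^ 2)⁻¹ := by
        refine Finset.sum_le_sum fun k _ => (le_abs_self _).trans ?_
        rw [abs_mul]
        exact (mul_le_of_le_one_right (abs_nonneg _) (Real.abs_cos_le_one _)).trans
          (abs_trapezoidCoeff_le_inv_sq hab k)
    _ = 1 / (4 * (b - a)) * ∑ k ∈ Finset.Ioo K n, ((k : ℝ) ^ 2)⁻¹ := by rw [Finset.mul_sum]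
    _ ≤ 1 / (4 * (b - a)) * (2 / (K + 1)) := by
        gcongr
        exact sum_Ioo_inv_sq_le K n
    _ = _ := by field_simp; norm_num

/-- A cosine polynomial of degree `K` above the indicator function of an arc. -/
theorem exists_cos_majorant {a : ℝ} (ha : 0 ≤ a) (K : ℕ) :
    ∃ c : ℕ → ℝ, 0 ≤ c 0 ∧ c 0 ≤ 2 * a + 2 / √(K + 1) ∧ (∀ k, 1 ≤ k → |c k| ≤ 1 / k) ∧
      ∀ x, (if distNearestInt x ≤ a then 1 else 0) ≤
        c 0 + ∑ k ∈ Finset.Icc 1 K, c k * Real.cos (2 * Real.pi * k * x) := by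
  have hr : 0 < 1 / √((K : ℝ) + 1) := by positivity
  have hsq : √((K : ℝ) + 1) * √((K : ℝ) + 1) = K + 1 := Real.mul_self_sqrt (by positivity)
  -- A ramp of this width balances the widening of the arc against the tail bound `1 / (2 * (b - a)
  -- * (K + 1))`.
  obtain ⟨b, hb⟩ : ∃ b, b = a + 1 / √((K : ℝ) + 1) := ⟨_, rfl⟩
  have h2 : 2 / √((K : ℝ) + 1) = 2 * (1 / √((K : ℝ) + 1)) := by ring
  rw [h2]
  by_cases hb' : b ≤ 1 / 2
  · have hab : a < b := by linarith
    have hba : b - a = 1 / √((K : ℝ) + 1) := by rw [hb]; ring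
    refine ⟨fun k => if k = 0 then a + b + 1 / √((K : ℝ) + 1) else trapezoidCoeff a b k,
      ?_, ?_, ?_, ?_⟩
    · simp only [if_true]; linarith
    · simp only [if_true]; linarith
    · intro k hk
      simp only [if_neg (by omega : k ≠ 0)]
      exact abs_trapezoidCoeff_le_inv hab hk
    · intro x
      have hs : ∑ k ∈ Finset.Icc 1 K, (if k = 0 then a + b + 1 / √((K : ℝ) + 1) else
          trapezoidCoeff a b k) * Real.cos (2 * Real.pi * k * x) =
          ∑ k ∈ Finset.Icc 1 K, trapezoidCoeff a b k * Real.cos (2 * Real.pi * k * x) := by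
        refine Finset.sum_congr rfl fun k hk => ?_
        rw [if_neg (by have := (Finset.mem_Icc.1 hk).1; omega)]
      rw [hs]
      simp only [if_true]
      have ht := trapezoid_tail_le ha hab hb' K x
      have hle : 1 / (2 * (b - a) * (K + 1)) ≤ 1 / √((K : ℝ) + 1) := by
        have hS : 0 < √((K : ℝ) + 1) := by positivity
        rw [hba]
        calc _ = 1 / (2 * (1 / √((K : ℝ) + 1)) * (√((K : ℝ) + 1) * √((K : ℝ) + 1))) := by rw [hsq]
          _ = 1 / 2 * (1 / √((K : ℝ) + 1)) := by
            generalize √((K : ℝ) + 1) = S at hS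
            field_simp
          _ ≤ _ := by linarith
      have hT : (if distNearestInt x ≤ a then (1 : ℝ) else 0) ≤
          (max (distNearestInt x) b - max (distNearestInt x) a) / (b - a) := by
        have hba0 : 0 < b - a := by linarith
        split_ifs with h
        · rw [max_eq_right h, max_eq_right (by linarith), div_self hba0.ne']
        · exact div_nonneg (sub_nonneg.2 (max_le_max_left _ hab.le)) hba0.le
      linarith
  -- There is no room for the ramp, but then the allowed mean `2 * b` exceeds `1`, so the constant
  -- `1` will do.
  · refine ⟨fun k => if k = 0 then 1 else 0, by simp, ?_, ?_, ?_⟩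
    · simp only [if_true]; linarith
    · intro k hk
      simp only [if_neg (by omega : k ≠ 0), abs_zero]
      positivity
    · intro x
      have hs : ∑ k ∈ Finset.Icc 1 K, (if k = 0 then (1 : ℝ) else 0) *
          Real.cos (2 * Real.pi * k * x) = 0 := by
        refine Finset.sum_eq_zero fun k hk => ?_
        rw [if_neg (by have := (Finset.mem_Icc.1 hk).1; omega), zero_mul]
      rw [hs]
      split_ifs <;> simp

/-- A cosine polynomial of degree `K` below the indicator function of an arc. -/
theorem exists_cos_minorant {a : ℝ} (ha' : a ≤ 1 / 2) (K : ℕ) :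
    ∃ c : ℕ → ℝ, 2 * a - 2 / √(K + 1) ≤ c 0 ∧ (∀ k, 1 ≤ k → |c k| ≤ 1 / k) ∧
      ∀ x, c 0 + ∑ k ∈ Finset.Icc 1 K, c k * Real.cos (2 * Real.pi * k * x) ≤
        if distNearestInt x ≤ a then 1 else 0 := by
  -- Subtract from `1` a majorant of the complementary arc, which is centred at `1 / 2`; the
  -- translation by `1 / 2` multiplies the `k`-th coefficient by `(-1) ^ k`.
  obtain ⟨c, -, h1, h2, h3⟩ :=
    exists_cos_majorant (a := 1 / 2 - a) (by linarith) K
  refine ⟨fun k => if k = 0 then 1 - c 0 else -(-1) ^ k * c k, ?_, ?_, ?_⟩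
  · simp only [if_true]; linarith
  · intro k hk
    simp only [if_neg (by omega : k ≠ 0)]
    rw [abs_mul, abs_neg, abs_pow, abs_neg, abs_one, one_pow, one_mul]
    exact h2 k hk
  · intro x
    have hs : ∑ k ∈ Finset.Icc 1 K, (if k = 0 then 1 - c 0 else -(-1) ^ k * c k) *
        Real.cos (2 * Real.pi * k * x) =
        -∑ k ∈ Finset.Icc 1 K, c k * Real.cos (2 * Real.pi * k * (x - 1 / 2)) := by
      rw [← Finset.sum_neg_distrib]
      refine Finset.sum_congr rfl fun k hk => ?_
      rw [if_neg (by have := (Finset.mem_Icc.1 hk).1; omega)]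
      have : 2 * Real.pi * k * (x - 1 / 2) = 2 * Real.pi * k * x - k * Real.pi := by ring
      rw [this, Real.cos_sub_nat_mul_pi]
      ring
    rw [hs]
    simp only [if_true]
    have := h3 (x - 1 / 2)
    split_ifs with h
    · split_ifs at this <;> linarith
    · rw [if_pos (distNearestInt_sub_half_le (not_le.1 h))] at this
      linarith

/-! ### Integrals of cosine polynomials against `μ`. -/

theorem norm_measureFourier_le_one (μ : Measure ℝ) [IsProbabilityMeasure μ] (t : ℝ) :
    ‖measureFourier μ t‖ ≤ 1 := by
  have h : ∀ x : ℝ, ‖Complex.exp (2 * Real.pi * Complex.I * ((-(t * x) : ℝ) : ℂ))‖ ≤ 1 := by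
    intro x
    have : 2 * Real.pi * Complex.I * ((-(t * x) : ℝ) : ℂ) =
        ((2 * Real.pi * (-(t * x)) : ℝ) : ℂ) * Complex.I := by push_cast; ring
    rw [this, Complex.norm_exp_ofReal_mul_I]
  have := norm_integral_le_of_norm_le_const (μ := μ) (Eventually.of_forall h)
  rwa [probReal_univ, mul_one] at this

/-- A phase shift multiplies the Fourier transform by a number of modulus one, so the inhomogeneous
term `γ` costs nothing. -/
theorem abs_integral_cos_le (μ : Measure ℝ) [IsProbabilityMeasure μ] (t s : ℝ) :
    |∫ x, Real.cos (2 * Real.pi * (t * x - s)) ∂μ| ≤ ‖measureFourier μ t‖ := by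
  have hint : Integrable
      (fun x : ℝ => Complex.exp (2 * Real.pi * Complex.I * ((-(t * x) : ℝ) : ℂ))) μ := by
    refine Integrable.of_bound (by fun_prop) 1 (Eventually.of_forall fun x => ?_)
    have : 2 * Real.pi * Complex.I * ((-(t * x) : ℝ) : ℂ) =
        ((2 * Real.pi * (-(t * x)) : ℝ) : ℂ) * Complex.I := by push_cast; ring
    rw [this, Complex.norm_exp_ofReal_mul_I]
  have h1 : ∫ x, Real.cos (2 * Real.pi * (t * x - s)) ∂μ =
      (Complex.exp ((2 * Real.pi * s : ℝ) * Complex.I) * measureFourier μ t).re := by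
    rw [measureFourier, ← integral_const_mul]
    have := integral_re (𝕜 := ℂ) (hint.const_mul (Complex.exp ((2 * Real.pi * s : ℝ) * Complex.I)))
    simp only [RCLike.re_to_complex] at this
    rw [← this]
    congr 1
    funext x
    rw [← Complex.exp_add]
    have h2 : ((2 * Real.pi * s : ℝ) : ℂ) * Complex.I +
        2 * Real.pi * Complex.I * ((-(t * x) : ℝ) : ℂ) =
        ((-(2 * Real.pi * (t * x - s)) : ℝ) : ℂ) * Complex.I := by push_cast; ring
    rw [h2, Complex.exp_ofReal_mul_I_re, Real.cos_neg]
  rw [h1]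
  refine (Complex.abs_re_le_norm _).trans ?_
  rw [norm_mul, Complex.norm_exp_ofReal_mul_I, one_mul]

/-- The non-constant part of a cosine polynomial. -/
noncomputable def cosSum (c : ℕ → ℝ) (K : ℕ) (x : ℝ) : ℝ :=
  ∑ k ∈ Finset.Icc 1 K, c k * Real.cos (2 * Real.pi * k * x)

/-- The harmonic numbers, as real numbers. -/
noncomputable def harmonicSum (K : ℕ) : ℝ := ∑ k ∈ Finset.Icc 1 K, 1 / (k : ℝ)

theorem harmonicSum_nonneg (K : ℕ) : 0 ≤ harmonicSum K :=
  Finset.sum_nonneg fun _ _ => by positivity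

theorem harmonicSum_mono : Monotone harmonicSum := fun _ _ h =>
  Finset.sum_le_sum_of_subset_of_nonneg (Finset.Icc_subset_Icc_right h) fun _ _ _ => by positivity

theorem continuous_cosSum (c : ℕ → ℝ) (K : ℕ) : Continuous (cosSum c K) := by
  unfold cosSum
  fun_prop

theorem abs_cosSum_le {c : ℕ → ℝ} (hc : ∀ k, 1 ≤ k → |c k| ≤ 1 / k) (K : ℕ) (x : ℝ) :
    |cosSum c K x| ≤ harmonicSum K := by
  refine (Finset.abs_sum_le_sum_abs _ _).trans (Finset.sum_le_sum fun k hk => ?_)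
  rw [abs_mul]
  exact (mul_le_of_le_one_right (abs_nonneg _) (Real.abs_cos_le_one _)).trans
    (hc k (Finset.mem_Icc.1 hk).1)

theorem integrable_cosSum {c : ℕ → ℝ} (hc : ∀ k, 1 ≤ k → |c k| ≤ 1 / k) (K : ℕ) (μ : Measure ℝ)
    [IsProbabilityMeasure μ] (q γ : ℝ) : Integrable (fun x => cosSum c K (q * x - γ)) μ :=
  Integrable.of_bound ((continuous_cosSum c K).comp (by fun_prop)).aestronglyMeasurable
    (harmonicSum K) (Eventually.of_forall fun x => abs_cosSum_le hc K _)

theorem integrable_cosSum_mul_cosSum {c d : ℕ → ℝ} (hc : ∀ k, 1 ≤ k → |c k| ≤ 1 / k)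
    (hd : ∀ k, 1 ≤ k → |d k| ≤ 1 / k) (K L : ℕ) (μ : Measure ℝ)
    [IsProbabilityMeasure μ] (q q' γ : ℝ) :
    Integrable (fun x => cosSum c K (q * x - γ) * cosSum d L (q' * x - γ)) μ := by
  refine (integrable_cosSum hd L μ q' γ).bdd_mul (c := harmonicSum K)
    ((continuous_cosSum c K).comp (by fun_prop)).aestronglyMeasurable
    (Eventually.of_forall fun x => abs_cosSum_le hc K _)

theorem abs_integral_cosSum_le {c : ℕ → ℝ} (hc : ∀ k, 1 ≤ k → |c k| ≤ 1 / k) (K : ℕ)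
    (μ : Measure ℝ) [IsProbabilityMeasure μ] (q γ : ℝ) {D : ℝ}
    (hD : ∀ t, |q| ≤ |t| → ‖measureFourier μ t‖ ≤ D) :
    |∫ x, cosSum c K (q * x - γ) ∂μ| ≤ harmonicSum K * D := by
  unfold cosSum
  rw [integral_finsetSum]
  · rw [harmonicSum, Finset.sum_mul]
    refine (Finset.abs_sum_le_sum_abs _ _).trans (Finset.sum_le_sum fun k hk => ?_)
    have hk1 := (Finset.mem_Icc.1 hk).1
    rw [integral_const_mul, abs_mul]
    refine mul_le_mul (hc k hk1) ?_ (abs_nonneg _) (by positivity)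
    have h1 : ∀ x : ℝ, 2 * Real.pi * k * (q * x - γ) =
        2 * Real.pi * ((k * q) * x - k * γ) := fun x => by ring
    simp_rw [h1]
    refine (abs_integral_cos_le μ _ _).trans (hD _ ?_)
    rw [abs_mul, Nat.abs_cast]
    exact le_mul_of_one_le_left (abs_nonneg _) (by exact_mod_cast hk1)
  · intro k _
    refine Integrable.const_mul (Integrable.of_bound (by fun_prop) 1
      (Eventually.of_forall fun x => Real.abs_cos_le_one _)) _

theorem abs_integral_cos_mul_cos_le (μ : Measure ℝ) [IsProbabilityMeasure μ] (t s t' s' : ℝ)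
    {D : ℝ} (h1 : ‖measureFourier μ (t + t')‖ ≤ D) (h2 : ‖measureFourier μ (t - t')‖ ≤ D) :
    |∫ x, Real.cos (2 * Real.pi * (t * x - s)) * Real.cos (2 * Real.pi * (t' * x - s')) ∂μ| ≤
      D := by
  have h : ∀ x : ℝ, Real.cos (2 * Real.pi * (t * x - s)) * Real.cos (2 * Real.pi * (t' * x - s')) =
      1 / 2 * Real.cos (2 * Real.pi * ((t + t') * x - (s + s'))) +
      1 / 2 * Real.cos (2 * Real.pi * ((t - t') * x - (s - s'))) := by
    intro x
    have e1 : 2 * Real.pi * ((t + t') * x - (s + s')) =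
      2 * Real.pi * (t * x - s) + 2 * Real.pi * (t' * x - s') := by ring
    have e2 : 2 * Real.pi * ((t - t') * x - (s - s')) =
      2 * Real.pi * (t * x - s) - 2 * Real.pi * (t' * x - s') := by ring
    rw [e1, e2, Real.cos_add, Real.cos_sub]
    ring
  have hi : ∀ t s : ℝ, Integrable (fun x : ℝ => 1 / 2 * Real.cos (2 * Real.pi * (t * x - s))) μ :=
    fun t s => Integrable.const_mul (Integrable.of_bound (by fun_prop) 1
      (Eventually.of_forall fun x => Real.abs_cos_le_one _)) _
  simp_rw [h]
  rw [integral_add (hi _ _) (hi _ _), integral_const_mul, integral_const_mul]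
  have a1 := abs_le.1 ((abs_integral_cos_le μ (t + t') (s + s')).trans h1)
  have a2 := abs_le.1 ((abs_integral_cos_le μ (t - t') (s - s')).trans h2)
  rw [abs_le]
  constructor <;> linarith

/-- The condition `hK` prevents resonance: every frequency `l * q' ± k * q` with `k ≤ K` and `l ≥ 1`
keeps absolute value at least `|q'| / 2`. -/
theorem abs_integral_cosSum_mul_cosSum_le {c d : ℕ → ℝ} (hc : ∀ k, 1 ≤ k → |c k| ≤ 1 / k)
    (hd : ∀ k, 1 ≤ k → |d k| ≤ 1 / k) (K L : ℕ) (μ : Measure ℝ) [IsProbabilityMeasure μ]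
    (q q' γ : ℝ) (hK : K * |q| ≤ |q'| / 2) {D : ℝ}
    (hD : ∀ t, |q'| / 2 ≤ |t| → ‖measureFourier μ t‖ ≤ D) :
    |∫ x, cosSum c K (q * x - γ) * cosSum d L (q' * x - γ) ∂μ| ≤
      harmonicSum K * harmonicSum L * D := by
  unfold cosSum
  simp_rw [Finset.sum_mul_sum]
  have hi : ∀ k l : ℕ, Integrable (fun x : ℝ => c k * Real.cos (2 * Real.pi * k * (q * x - γ)) *
      (d l * Real.cos (2 * Real.pi * l * (q' * x - γ)))) μ := by
    intro k l
    refine Integrable.of_bound (by fun_prop) (|c k| * |d l|) (Eventually.of_forall fun x => ?_)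
    rw [norm_mul, norm_mul, norm_mul]
    exact mul_le_mul (mul_le_of_le_one_right (abs_nonneg _) (Real.abs_cos_le_one _))
      (mul_le_of_le_one_right (abs_nonneg _) (Real.abs_cos_le_one _)) (by positivity)
      (by positivity)
  rw [integral_finsetSum _ fun k _ => integrable_finsetSum _ fun l _ => hi k l]
  simp_rw [integral_finsetSum _ fun l _ => hi _ l]
  rw [harmonicSum, harmonicSum, Finset.sum_mul_sum, Finset.sum_mul]
  refine (Finset.abs_sum_le_sum_abs _ _).trans (Finset.sum_le_sum fun k hk => ?_)
  rw [Finset.sum_mul]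
  refine (Finset.abs_sum_le_sum_abs _ _).trans (Finset.sum_le_sum fun l hl => ?_)
  obtain ⟨hk1, hk2⟩ := Finset.mem_Icc.1 hk
  have hl1 := (Finset.mem_Icc.1 hl).1
  have h1 : ∀ x : ℝ, c k * Real.cos (2 * Real.pi * k * (q * x - γ)) *
      (d l * Real.cos (2 * Real.pi * l * (q' * x - γ))) = (c k * d l) *
      (Real.cos (2 * Real.pi * ((k * q) * x - k * γ)) *
        Real.cos (2 * Real.pi * ((l * q') * x - l * γ))) := by
    intro x
    rw [show 2 * Real.pi * ((k * q) * x - k * γ) = 2 * Real.pi * k * (q * x - γ) by ring,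
      show 2 * Real.pi * ((l * q') * x - l * γ) = 2 * Real.pi * l * (q' * x - γ) by ring]
    ring
  simp_rw [h1]
  rw [integral_const_mul, abs_mul, abs_mul]
  have hkq : |(k : ℝ) * q| ≤ |q'| / 2 := by
    rw [abs_mul, Nat.abs_cast]
    refine le_trans ?_ hK
    gcongr
  have hlq : |q'| ≤ |(l : ℝ) * q'| := by
    rw [abs_mul, Nat.abs_cast]
    exact le_mul_of_one_le_left (abs_nonneg _) (by exact_mod_cast hl1)
  refine mul_le_mul (mul_le_mul (hc k hk1) (hd l hl1) (abs_nonneg _) (by positivity)) ?_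
    (abs_nonneg _) (by positivity)
  refine abs_integral_cos_mul_cos_le μ _ _ _ _ (hD _ ?_) (hD _ ?_)
  · have := abs_sub_abs_le_abs_sub ((l : ℝ) * q') (-(k * q))
    rw [abs_neg, sub_neg_eq_add, add_comm] at this
    rw [add_comm (_ * q)]
    rw [add_comm] at this
    linarith
  · have := abs_sub_abs_le_abs_sub ((l : ℝ) * q') (k * q)
    rw [abs_sub_comm]
    linarith

/-! ### Measures of the hit sets and of their intersections. -/

/-- The points `x` for which `q n * x - γ` lies within `ψ (q n)` of an integer. -/
def hitSet (q : ℕ → ℝ) (γ : ℝ) (ψ : ℝ → ℝ) (n : ℕ) : Set ℝ :=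
  {x | distNearestInt (q n * x - γ) ≤ ψ (q n)}

theorem measurableSet_hitSet (q : ℕ → ℝ) (γ : ℝ) (ψ : ℝ → ℝ) (n : ℕ) :
    MeasurableSet (hitSet q γ ψ n) :=
  measurableSet_le (measurable_distNearestInt.comp (by fun_prop)) measurable_const

theorem indicator_hitSet (q : ℕ → ℝ) (γ : ℝ) (ψ : ℝ → ℝ) (n : ℕ) (x : ℝ) :
    (hitSet q γ ψ n).indicator (1 : ℝ → ℝ) x =
      if distNearestInt (q n * x - γ) ≤ ψ (q n) then 1 else 0 := by
  classical
  rw [Set.indicator_apply]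
  rfl

theorem abs_measureReal_hitSet_sub_le (μ : Measure ℝ) [IsProbabilityMeasure μ] (q : ℕ → ℝ)
    (γ : ℝ) (ψ : ℝ → ℝ) (n : ℕ) (h0 : 0 ≤ ψ (q n)) (h2 : ψ (q n) ≤ 1 / 2) (K : ℕ) {D : ℝ}
    (hD : ∀ t, |q n| ≤ |t| → ‖measureFourier μ t‖ ≤ D) :
    |μ.real (hitSet q γ ψ n) - 2 * ψ (q n)| ≤ 2 / √(K + 1) + harmonicSum K * D := by
  have hm := measurableSet_hitSet q γ ψ n
  have hi : Integrable ((hitSet q γ ψ n).indicator (1 : ℝ → ℝ)) μ :=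
    (integrable_const (1 : ℝ)).indicator hm
  rw [← integral_indicator_one hm, abs_le]
  constructor
  · obtain ⟨c, hc0, hc, hx⟩ := exists_cos_minorant h2 K
    have hs := integrable_cosSum hc K μ (q n) γ
    have h1 : ∫ x, (c 0 + cosSum c K (q n * x - γ)) ∂μ ≤
        ∫ x, (hitSet q γ ψ n).indicator (1 : ℝ → ℝ) x ∂μ := by
      refine integral_mono ((integrable_const (c 0)).add hs) hi fun x => ?_
      simp only [indicator_hitSet]
      exact hx _
    rw [integral_add (integrable_const _) hs, integral_const] at h1
    have := abs_le.1 (abs_integral_cosSum_le hc K μ (q n) γ hD)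
    simp at h1
    linarith
  · obtain ⟨c, -, hc0, hc, hx⟩ := exists_cos_majorant h0 K
    have hs := integrable_cosSum hc K μ (q n) γ
    have h1 : ∫ x, (hitSet q γ ψ n).indicator (1 : ℝ → ℝ) x ∂μ ≤
        ∫ x, (c 0 + cosSum c K (q n * x - γ)) ∂μ := by
      refine integral_mono hi ((integrable_const (c 0)).add hs) fun x => ?_
      simp only [indicator_hitSet]
      exact hx _
    rw [integral_add (integrable_const _) hs, integral_const] at h1
    have := abs_le.1 (abs_integral_cosSum_le hc K μ (q n) γ hD)
    simp at h1
    linarith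

/-- Majorants dominate nonnegative indicators, so their product dominates the indicator of the
intersection. An upper bound is enough, since only an upper bound for the variance is wanted. -/
theorem measureReal_hitSet_inter_le (μ : Measure ℝ) [IsProbabilityMeasure μ] (q : ℕ → ℝ)
    (γ : ℝ) (ψ : ℝ → ℝ) (m n : ℕ) (hm0 : 0 ≤ ψ (q m))
    (hn0 : 0 ≤ ψ (q n)) (K L : ℕ) (hK : K * |q m| ≤ |q n| / 2)
    {D D' : ℝ} (hD : ∀ t, |q m| ≤ |t| → ‖measureFourier μ t‖ ≤ D)
    (hD' : ∀ t, |q n| / 2 ≤ |t| → ‖measureFourier μ t‖ ≤ D') :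
    μ.real (hitSet q γ ψ m ∩ hitSet q γ ψ n) ≤
      (2 * ψ (q m) + 2 / √(K + 1)) * (2 * ψ (q n) + 2 / √(L + 1)) +
      (2 * ψ (q m) + 2 / √(K + 1)) * (harmonicSum L * D') +
      (2 * ψ (q n) + 2 / √(L + 1)) * (harmonicSum K * D) +
      harmonicSum K * harmonicSum L * D' := by
  have hmm := measurableSet_hitSet q γ ψ m
  have hmn := measurableSet_hitSet q γ ψ n
  obtain ⟨c, hc0, hc1, hc, hcx⟩ := exists_cos_majorant hm0 K
  obtain ⟨d, hd0, hd1, hd, hdx⟩ := exists_cos_majorant hn0 L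
  have hsc := integrable_cosSum hc K μ (q m) γ
  have hsd := integrable_cosSum hd L μ (q n) γ
  have hscd := integrable_cosSum_mul_cosSum hc hd K L μ (q m) (q n) γ
  have hi := (integrable_const (μ := μ) (1 : ℝ)).indicator (hmm.inter hmn)
  have a1 : Integrable (fun x => c 0 * d 0 + c 0 * cosSum d L (q n * x - γ)) μ :=
    (integrable_const _).add (hsd.const_mul _)
  have a2 : Integrable (fun x => c 0 * d 0 + c 0 * cosSum d L (q n * x - γ) +
    d 0 * cosSum c K (q m * x - γ)) μ := a1.add (hsc.const_mul _)
  have h1 : ∫ x, (hitSet q γ ψ m ∩ hitSet q γ ψ n).indicator (1 : ℝ → ℝ) x ∂μ ≤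
      ∫ x, (c 0 * d 0 + c 0 * cosSum d L (q n * x - γ) + d 0 * cosSum c K (q m * x - γ) +
        cosSum c K (q m * x - γ) * cosSum d L (q n * x - γ)) ∂μ := by
    refine integral_mono hi (a2.add hscd) fun x => ?_
    simp only [Set.inter_indicator_one, Pi.mul_apply, indicator_hitSet]
    refine (mul_le_mul (hcx _) (hdx _) (by positivity)
      (le_trans (by positivity) (hcx (q m * x - γ)))).trans (le_of_eq ?_)
    unfold cosSum
    ring
  rw [integral_indicator_one (hmm.inter hmn),
    integral_add a2 hscd, integral_add a1 (hsc.const_mul _),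
    integral_add (integrable_const _) (hsd.const_mul _), integral_const, integral_const_mul,
    integral_const_mul] at h1
  have hD'' : ∀ t, |q n| ≤ |t| → ‖measureFourier μ t‖ ≤ D' := fun t ht =>
    hD' t (by linarith [abs_nonneg (q n)])
  have e1 := (abs_le.1 (abs_integral_cosSum_le hc K μ (q m) γ hD)).2
  have e2 := (abs_le.1 (abs_integral_cosSum_le hd L μ (q n) γ hD'')).2
  have e3 := (abs_le.1 (abs_integral_cosSum_mul_cosSum_le hc hd K L μ (q m) (q n) γ hK hD')).2
  have hHK := harmonicSum_nonneg K
  have hHL := harmonicSum_nonneg L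
  have hD0 : 0 ≤ D := (norm_nonneg _).trans (hD (q m) le_rfl)
  have hD0' : 0 ≤ D' := (norm_nonneg _).trans (hD'' (q n) le_rfl)
  simp only [probReal_univ, one_smul] at h1
  refine h1.trans ?_
  gcongr ?_ + ?_ + ?_ + ?_
  · exact mul_le_mul hc1 hd1 hd0 (hc0.trans hc1)
  · exact (mul_le_mul_of_nonneg_left e2 hc0).trans
      (mul_le_mul_of_nonneg_right hc1 (by positivity))
  · exact (mul_le_mul_of_nonneg_left e1 hd0).trans
      (mul_le_mul_of_nonneg_right hd1 (by positivity))

/-! ### Lacunarity, decay along the sequence, and quasi-independence. -/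

theorem abs_ge_pow_mul_abs_of_ratio_ge {q : ℕ → ℝ} {C : ℝ} (hC : 1 < C)
    (hq : ∀ n : ℕ, 1 ≤ n → C ≤ q (n + 1) / q n) {m n : ℕ} (hm : 1 ≤ m) (hmn : m ≤ n) :
    C ^ (n - m) * |q m| ≤ |q n| := by
  induction n, hmn using Nat.le_induction with
  | base => simp
  | succ n hmn ih =>
    have h := hq n (hm.trans hmn)
    have h0 : q n ≠ 0 := by
      intro h0
      rw [h0, div_zero] at h
      linarith
    have h1 : C * |q n| ≤ |q (n + 1)| := by
      have := h.trans (le_abs_self _)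
      rw [abs_div] at this
      exact (le_div_iff₀ (abs_pos.2 h0)).1 this
    rw [Nat.succ_sub hmn, pow_succ]
    calc C ^ (n - m) * C * |q m| = C * (C ^ (n - m) * |q m|) := by ring
      _ ≤ C * |q n| := by gcongr
      _ ≤ _ := h1

/-- A logarithmic decay rate becomes a power of the index along a lacunary sequence. -/
theorem exists_measureFourier_le_rpow (μ : Measure ℝ) [IsProbabilityMeasure μ] {A : ℝ} (hA : 0 < A)
    (hdecay : Asymptotics.IsBigO (cocompact ℝ) (measureFourier μ)
      (fun t => Real.log |t| ^ (-A)))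
    {q : ℕ → ℝ} {C : ℝ} (hC : 1 < C) (hq : ∀ n : ℕ, 1 ≤ n → C ≤ q (n + 1) / q n) :
    ∃ M : ℝ, 0 ≤ M ∧ ∀ n : ℕ, 1 ≤ n → ∀ t, |q n| / 2 ≤ |t| →
      ‖measureFourier μ t‖ ≤ M * (n : ℝ) ^ (-A) := by
  obtain ⟨c, hc, hb⟩ := hdecay.exists_pos
  rw [Asymptotics.isBigOWith_iff, ← Metric.cobounded_eq_cocompact, ← comap_norm_atTop,
    eventually_comap, eventually_atTop] at hb
  obtain ⟨T, hT⟩ := hb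
  have hq1 : 0 < |q 1| := by
    rw [abs_pos]
    intro h0
    have := hq 1 le_rfl
    rw [h0, div_zero] at this
    linarith
  have hlogC : 0 < Real.log C := Real.log_pos hC
  -- Half of the growth rate `log C` is given up to absorb the additive constants in `log (|q n| /
  -- 2)`.
  obtain ⟨κ, hκ⟩ : ∃ κ, κ = Real.log C / 2 := ⟨_, rfl⟩
  have hκ0 : 0 < κ := by rw [hκ]; positivity
  have hlin : Tendsto (fun n : ℕ => κ * (n : ℝ)) atTop atTop :=
    tendsto_natCast_atTop_atTop.const_mul_atTop hκ0
  obtain ⟨n₀, hn₀⟩ := eventually_atTop.1 ((hlin.eventually_ge_atTop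
    (Real.log C - Real.log (|q 1| / 2))).and
    (hlin.eventually_ge_atTop (Real.log (max T 1))))
  -- The first summand serves `n ≥ n₀`; for `n < n₀` the trivial bound `1 ≤ n₀ ^ A * n ^ (-A)`
  -- suffices.
  refine ⟨c * κ ^ (-A) + (n₀ : ℝ) ^ A, by positivity, fun n hn t ht => ?_⟩
  have hn' : (0 : ℝ) < n := by exact_mod_cast hn
  rcases lt_or_ge n n₀ with h | h
  · refine (norm_measureFourier_le_one μ t).trans ?_
    have h1 : (1 : ℝ) ≤ (n₀ : ℝ) ^ A * (n : ℝ) ^ (-A) := by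
      rw [Real.rpow_neg hn'.le, ← div_eq_mul_inv, one_le_div (by positivity)]
      exact Real.rpow_le_rpow hn'.le (by exact_mod_cast h.le) hA.le
    have h2 : 0 ≤ c * κ ^ (-A) * (n : ℝ) ^ (-A) := by positivity
    rw [add_mul]
    linarith
  · obtain ⟨e1, e2⟩ := hn₀ n h
    have hgrow := abs_ge_pow_mul_abs_of_ratio_ge hC hq le_rfl hn
    have hlog : κ * n ≤ Real.log (|q n| / 2) := by
      have h1 : Real.log (C ^ (n - 1) * (|q 1| / 2)) ≤ Real.log (|q n| / 2) :=
        Real.log_le_log (by positivity) (by linarith)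
      rw [Real.log_mul (by positivity) (by positivity), Real.log_pow, Nat.cast_sub hn] at h1
      push_cast at h1
      have : Real.log C = 2 * κ := by rw [hκ]; ring
      rw [this] at h1 e1
      nlinarith
    have hqn : 0 < |q n| / 2 := by
      have : 0 < C ^ (n - 1) * |q 1| := by positivity
      linarith
    have hlt : κ * n ≤ Real.log |t| := hlog.trans (Real.log_le_log hqn ht)
    have htT : T ≤ |t| := by
      refine (le_max_left T 1).trans (le_trans ?_ ht)
      exact (Real.log_le_log_iff (by positivity) hqn).1 (e2.trans hlog)
    have h1 := hT |t| htT t rfl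
    have hκn : 0 < κ * n := by positivity
    refine h1.trans ?_
    rw [Real.norm_of_nonneg (Real.rpow_nonneg (hκn.le.trans hlt) _)]
    calc c * Real.log |t| ^ (-A) ≤ c * (κ * n) ^ (-A) :=
          mul_le_mul_of_nonneg_left
            (Real.rpow_le_rpow_of_nonpos hκn hlt (by linarith)) hc.le
      _ = c * κ ^ (-A) * (n : ℝ) ^ (-A) := by
          rw [Real.mul_rpow hκ0.le hn'.le, mul_assoc]
      _ ≤ _ := by
          gcongr
          have : 0 ≤ (n₀ : ℝ) ^ A := by positivity
          linarith

theorem harmonicSum_le_one_add_log (K : ℕ) : harmonicSum K ≤ 1 + Real.log K := by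
  have h := harmonic_le_one_add_log K
  rw [harmonic_eq_sum_Icc] at h
  push_cast at h
  simpa [harmonicSum] using h

/-- Degree `n ^ 6` makes the smoothing error at most `n ^ (-3)`, while the harmonic sum stays
logarithmic and is absorbed by any power `n ^ δ`. -/
theorem harmonicSum_pow_six_le {δ : ℝ} (hδ : 0 < δ) {n : ℕ} (hn : 1 ≤ n) :
    harmonicSum (n ^ 6) ≤ (1 + 6 / δ) * (n : ℝ) ^ δ := by
  have hn' : (1 : ℝ) ≤ n := by exact_mod_cast hn
  refine (harmonicSum_le_one_add_log _).trans ?_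
  push_cast
  rw [Real.log_pow]
  have h1 := Real.log_le_rpow_div (by linarith : (0 : ℝ) ≤ n) hδ
  have h2 := Real.one_le_rpow hn' hδ.le
  push_cast
  calc 1 + 6 * Real.log n ≤ (n : ℝ) ^ δ + 6 * ((n : ℝ) ^ δ / δ) := by gcongr
    _ = _ := by ring

theorem one_div_sqrt_pow_six_le {δ : ℝ} (hδ : δ ≤ 1) {n : ℕ} (hn : 1 ≤ n) :
    1 / √(((n ^ 6 : ℕ) : ℝ) + 1) ≤ (n : ℝ) ^ (-(2 + δ)) := by
  have hn' : (1 : ℝ) ≤ n := by exact_mod_cast hn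
  have h1 : (n : ℝ) ^ 3 ≤ √(((n ^ 6 : ℕ) : ℝ) + 1) := by
    refine Real.le_sqrt_of_sq_le ?_
    push_cast
    nlinarith
  calc 1 / √(((n ^ 6 : ℕ) : ℝ) + 1) ≤ 1 / (n : ℝ) ^ 3 := by gcongr
    _ = (n : ℝ) ^ (-(3 : ℝ)) := by
        rw [Real.rpow_neg (by linarith), one_div]
        norm_cast
    _ ≤ _ := Real.rpow_le_rpow_of_exponent_le hn' (by linarith)

/-- First moments and pair correlations of the sets `hitSet q γ ψ n`. -/
theorem exists_hitSet_bounds {q : ℕ → ℝ} (hq : IsLacunary q) (γ : ℝ) {ψ : ℝ → ℝ}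
    (hψ : ∀ t, ψ t ∈ Set.Ioo (0 : ℝ) 1) (hψ_half : ∀ n : ℕ, 1 ≤ n → ψ (q n) ≤ 1 / 2)
    (μ : Measure ℝ) [IsProbabilityMeasure μ]
    (hdecay : ∃ A : ℝ, 2 < A ∧
      Asymptotics.IsBigO (cocompact ℝ) (measureFourier μ) (fun t => Real.log |t| ^ (-A))) :
    ∃ δ θ B : ℝ, 0 < δ ∧ 0 < θ ∧ θ < 1 ∧ 0 ≤ B ∧
      (∀ n : ℕ, 1 ≤ n → |μ.real (hitSet q γ ψ n) - 2 * ψ (q n)| ≤ B * (n : ℝ) ^ (-(2 + δ))) ∧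
      ∀ m n : ℕ, 1 ≤ m → m < n → μ.real (hitSet q γ ψ m ∩ hitSet q γ ψ n) ≤
        4 * ψ (q m) * ψ (q n) + B * (ψ (q n) * (θ ^ (n - m) + (m : ℝ) ^ (-(2 + δ))) +
          (n : ℝ) ^ (-(2 + δ))) := by
  obtain ⟨C, hC, hq⟩ := hq
  obtain ⟨A, hA, hdecay⟩ := hdecay
  obtain ⟨M, hM, hD⟩ := exists_measureFourier_le_rpow μ (by linarith) hdecay hC hq
  -- Two harmonic sums cost `n ^ (2 * δ)`, and `2 * δ - A` must not exceed `-(2 + δ)`. The cap `1`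
  -- lets the smoothing error `n ^ (-3)` fit under `n ^ (-(2 + δ))`.
  obtain ⟨δ, hδ⟩ : ∃ δ, δ = min ((A - 2) / 4) 1 := ⟨_, rfl⟩
  have hδ0 : 0 < δ := by
    rw [hδ]
    exact lt_min (by linarith) one_pos
  have hδ1 : δ ≤ 1 := by rw [hδ]; exact min_le_right _ _
  have hδA : 2 + 4 * δ ≤ A := by
    have : δ ≤ (A - 2) / 4 := by rw [hδ]; exact min_le_left _ _
    linarith
  obtain ⟨h, hh⟩ : ∃ h, h = 1 + 6 / δ := ⟨_, rfl⟩
  have hh1 : 1 ≤ h := by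
    have : 0 < 6 / δ := by positivity
    linarith
  have hsqrtC : 1 < √C := by
    rw [Real.lt_sqrt (by norm_num)]
    linarith
  have hHD : ∀ n : ℕ, 1 ≤ n →
      harmonicSum (n ^ 6) * harmonicSum (n ^ 6) * (M * (n : ℝ) ^ (-A)) ≤
        h ^ 2 * M * (n : ℝ) ^ (-(2 + δ)) := by
    intro n hn
    have hn' : (1 : ℝ) ≤ n := by exact_mod_cast hn
    have e := harmonicSum_pow_six_le hδ0 hn
    rw [← hh] at e
    have e0 := harmonicSum_nonneg (n ^ 6)
    calc _ ≤ (h * (n : ℝ) ^ δ) * (h * (n : ℝ) ^ δ) * (M * (n : ℝ) ^ (-A)) := by gcongr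
      _ = h ^ 2 * M * ((n : ℝ) ^ δ * (n : ℝ) ^ δ * (n : ℝ) ^ (-A)) := by ring
      _ = h ^ 2 * M * (n : ℝ) ^ (δ + δ + -A) := by
          rw [← Real.rpow_add (by linarith), ← Real.rpow_add (by linarith)]
      _ ≤ _ := by
          gcongr
          linarith
  have hHD1 : ∀ n : ℕ, 1 ≤ n →
      harmonicSum (n ^ 6) * (M * (n : ℝ) ^ (-A)) ≤ h ^ 2 * M * (n : ℝ) ^ (-(2 + δ)) := by
    intro n hn
    refine le_trans ?_ (hHD n hn)
    have h1 : 1 ≤ harmonicSum (n ^ 6) := by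
      have : harmonicSum 1 = 1 := by simp [harmonicSum]
      rw [← this]
      exact harmonicSum_mono (Nat.one_le_pow _ _ hn)
    have e0 : 0 ≤ harmonicSum (n ^ 6) * (M * (n : ℝ) ^ (-A)) := by positivity
    nlinarith
  have hB0 : 0 ≤ h ^ 2 * M := by positivity
  obtain ⟨B₀, hB₀⟩ : ∃ B₀, B₀ = h ^ 2 * M := ⟨_, rfl⟩
  rw [← hB₀] at hB0 hHD hHD1
  have hτ : ∀ n : ℕ, 1 ≤ n → (n : ℝ) ^ (-(2 + δ)) ≤ 1 := fun n hn =>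
    Real.rpow_le_one_of_one_le_of_nonpos (by exact_mod_cast hn) (by linarith)
  have hD1 : ∀ n : ℕ, 1 ≤ n → ∀ t, |q n| ≤ |t| → ‖measureFourier μ t‖ ≤ M * (n : ℝ) ^ (-A) :=
    fun n hn t ht => hD n hn t (by linarith [abs_nonneg (q n)])
  refine ⟨δ, 1 / √C, 8 + 6 * B₀, hδ0, by positivity, (div_lt_one (by positivity)).2 hsqrtC,
    by positivity, ?_, ?_⟩
  · intro n hn
    refine (abs_measureReal_hitSet_sub_le μ q γ ψ n (hψ _).1.le (hψ_half n hn) (n ^ 6)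
      (hD1 n hn)).trans ?_
    have e1 := one_div_sqrt_pow_six_le hδ1 hn
    have e2 := hHD1 n hn
    have e3 : 2 / √(((n ^ 6 : ℕ) : ℝ) + 1) = 2 * (1 / √(((n ^ 6 : ℕ) : ℝ) + 1)) := by ring
    rw [e3]
    have : 0 ≤ (n : ℝ) ^ (-(2 + δ)) := by positivity
    nlinarith [mul_nonneg hB0 this]
  · intro m n hm hmn
    have hn : 1 ≤ n := hm.trans hmn.le
    -- The first entry enforces non-resonance, `K * |q m| ≤ |q n| / 2`; the second keeps the
    -- harmonic sum logarithmic in `m`. The smoothing error is then a multiple of `(1 / √C) ^ (n -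
    -- m)` or at most `m ^ (-(2 + δ))`, according to which entry is the smaller. `K = 0` is
    -- permitted.
    obtain ⟨K, hK⟩ : ∃ K, K = min ⌊C ^ (n - m) / 2⌋₊ (m ^ 6) := ⟨_, rfl⟩
    have hKq : (K : ℝ) * |q m| ≤ |q n| / 2 := by
      have h1 : (K : ℝ) ≤ C ^ (n - m) / 2 := by
        refine le_trans ?_ (Nat.floor_le (by positivity))
        exact_mod_cast hK ▸ min_le_left _ _
      calc (K : ℝ) * |q m| ≤ C ^ (n - m) / 2 * |q m| := by gcongr
        _ = C ^ (n - m) * |q m| / 2 := by ring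
        _ ≤ _ := by
          gcongr
          exact abs_ge_pow_mul_abs_of_ratio_ge hC hq hm hmn.le
    have hmain := measureReal_hitSet_inter_le μ q γ ψ m n (hψ _).1.le (hψ _).1.le K (n ^ 6) hKq
      (hD1 m hm) (hD n hn)
    have hKm : K ≤ m ^ 6 := hK ▸ min_le_right _ _
    have hHK : harmonicSum K * (M * (m : ℝ) ^ (-A)) ≤ B₀ * (m : ℝ) ^ (-(2 + δ)) := by
      refine le_trans ?_ (hHD1 m hm)
      gcongr
      exact harmonicSum_mono hKm
    have hHKL : harmonicSum K * harmonicSum (n ^ 6) * (M * (n : ℝ) ^ (-A)) ≤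
        B₀ * (n : ℝ) ^ (-(2 + δ)) := by
      refine le_trans ?_ (hHD n hn)
      have := harmonicSum_nonneg (n ^ 6)
      gcongr
      exact harmonicSum_mono (hKm.trans (Nat.pow_le_pow_left hmn.le 6))
    have hHL := hHD1 n hn
    have hρ := one_div_sqrt_pow_six_le hδ1 hn
    have hr : 1 / √((K : ℝ) + 1) ≤ 2 * (1 / √C) ^ (n - m) + (m : ℝ) ^ (-(2 + δ)) := by
      have hθ0 : 0 ≤ (1 / √C) ^ (n - m) := by positivity
      have hτ0 : 0 ≤ (m : ℝ) ^ (-(2 + δ)) := by positivity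
      rcases min_choice ⌊C ^ (n - m) / 2⌋₊ (m ^ 6) with hc | hc <;> rw [hc] at hK
      · have h1 : √C ^ (n - m) / 2 ≤ √((K : ℝ) + 1) := by
          refine Real.le_sqrt_of_sq_le ?_
          have h2 := Nat.lt_floor_add_one (C ^ (n - m) / 2)
          rw [← hK] at h2
          rw [div_pow, ← pow_mul, mul_comm (n - m) 2, pow_mul, Real.sq_sqrt (by linarith)]
          have : 0 < C ^ (n - m) := by positivity
          linarith
        have h3 : 1 / √((K : ℝ) + 1) ≤ 1 / (√C ^ (n - m) / 2) := by gcongr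
        have h4 : 1 / (√C ^ (n - m) / 2) = 2 * (1 / √C) ^ (n - m) := by
          rw [one_div_pow, one_div_div, mul_one_div]
        linarith
      · rw [hK]
        have := one_div_sqrt_pow_six_le hδ1 hm
        linarith
    have hr1 : 1 / √((K : ℝ) + 1) ≤ 1 := by
      rw [div_le_one (by positivity), Real.one_le_sqrt]
      have : (0 : ℝ) ≤ K := by positivity
      linarith
    have e2 : ∀ y : ℝ, 2 / y = 2 * (1 / y) := fun y => by ring
    rw [e2, e2] at hmain
    have hr0 : 0 ≤ 1 / √((K : ℝ) + 1) := by positivity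
    have hρ0 : 0 ≤ 1 / √(((n ^ 6 : ℕ) : ℝ) + 1) := by positivity
    have hτn := hτ n hn
    have hτn0 : 0 ≤ (n : ℝ) ^ (-(2 + δ)) := by positivity
    have hτm := hτ m hm
    have hτm0 : 0 ≤ (m : ℝ) ^ (-(2 + δ)) := by positivity
    have hθ0 : 0 ≤ (1 / √C) ^ (n - m) := by positivity
    have hp0 := (hψ (q m)).1.le
    have hs0 := (hψ (q n)).1.le
    have hp := hψ_half m hm
    have hs := hψ_half n hn
    generalize 1 / √((K : ℝ) + 1) = r at *
    generalize 1 / √(((n ^ 6 : ℕ) : ℝ) + 1) = ρ at *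
    generalize harmonicSum K * harmonicSum (n ^ 6) * (M * (n : ℝ) ^ (-A)) = c at *
    generalize harmonicSum (n ^ 6) * (M * (n : ℝ) ^ (-A)) = a at *
    generalize harmonicSum K * (M * (m : ℝ) ^ (-A)) = b at *
    generalize (n : ℝ) ^ (-(2 + δ)) = τn at *
    generalize (m : ℝ) ^ (-(2 + δ)) = τm at *
    generalize (1 / √C) ^ (n - m) = t at *
    generalize ψ (q m) = p at *
    generalize ψ (q n) = s at *
    -- The error `r` need not be small in `n`, so it must keep its factor `s = ψ (q n)`; summed over
    -- `m` it then costs only a multiple of `ψ (q n)`. Terms containing `ρ` go into `τn`, using `p ≤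
    -- 1 / 2` and `r ≤ 1`.
    have i1 : (2 * p + 2 * r) * (2 * s + 2 * ρ) ≤ 4 * p * s + 4 * s * (2 * t + τm) + 6 * τn := by
      have j1 : s * r ≤ s * (2 * t + τm) := mul_le_mul_of_nonneg_left hr hs0
      have j2 : (4 * p + 4 * r) * ρ ≤ 6 * τn := mul_le_mul (by linarith) hρ hρ0 (by norm_num)
      nlinarith
    have i2 : (2 * p + 2 * r) * a ≤ 3 * (B₀ * τn) :=
      (mul_le_mul_of_nonneg_left hHL (by positivity)).trans
        (mul_le_mul_of_nonneg_right (by linarith) (by positivity))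
    have i3 : (2 * s + 2 * ρ) * b ≤ 2 * s * (B₀ * τm) + 2 * (B₀ * τn) := by
      refine (mul_le_mul_of_nonneg_left hHK (by positivity)).trans ?_
      have j1 : B₀ * (ρ * τm) ≤ B₀ * (τn * 1) :=
        mul_le_mul_of_nonneg_left (mul_le_mul hρ hτm hτm0 hτn0) hB0
      nlinarith
    have k1 : 0 ≤ s * t := by positivity
    have k2 : 0 ≤ s * τm := by positivity
    have k3 : 0 ≤ B₀ * (s * t) := by positivity
    have k4 : 0 ≤ B₀ * (s * τm) := by positivity
    nlinarith

/-! ### The variance of the count over a block. -/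

/-- The centred indicator function of `hitSet q γ ψ n`. -/
noncomputable def hitDeviation (q : ℕ → ℝ) (γ : ℝ) (ψ : ℝ → ℝ) (n : ℕ) (x : ℝ) : ℝ :=
  (hitSet q γ ψ n).indicator 1 x - 2 * ψ (q n)

theorem measurable_hitDeviation (q : ℕ → ℝ) (γ : ℝ) (ψ : ℝ → ℝ) (n : ℕ) :
    Measurable (hitDeviation q γ ψ n) :=
  (measurable_one.indicator (measurableSet_hitSet q γ ψ n)).sub_const _

theorem abs_hitDeviation_le (q : ℕ → ℝ) (γ : ℝ) (ψ : ℝ → ℝ) (n : ℕ) (x : ℝ) :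
    |hitDeviation q γ ψ n x| ≤ 1 + |2 * ψ (q n)| := by
  refine (abs_sub _ _).trans ?_
  gcongr
  rw [indicator_hitSet]
  split_ifs <;> simp

theorem integral_hitDeviation_mul (μ : Measure ℝ) [IsProbabilityMeasure μ] (q : ℕ → ℝ) (γ : ℝ)
    (ψ : ℝ → ℝ) (m n : ℕ) :
    ∫ x, hitDeviation q γ ψ m x * hitDeviation q γ ψ n x ∂μ =
      μ.real (hitSet q γ ψ m ∩ hitSet q γ ψ n) - 2 * ψ (q n) * μ.real (hitSet q γ ψ m) -
        2 * ψ (q m) * μ.real (hitSet q γ ψ n) + 4 * ψ (q m) * ψ (q n) := by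
  have hm := measurableSet_hitSet q γ ψ m
  have hn := measurableSet_hitSet q γ ψ n
  have hi : ∀ s : Set ℝ, MeasurableSet s → Integrable (s.indicator (1 : ℝ → ℝ)) μ := fun s hs =>
    (integrable_const (1 : ℝ)).indicator hs
  have h : ∀ x, hitDeviation q γ ψ m x * hitDeviation q γ ψ n x =
      (hitSet q γ ψ m ∩ hitSet q γ ψ n).indicator 1 x -
        2 * ψ (q n) * (hitSet q γ ψ m).indicator 1 x -
        2 * ψ (q m) * (hitSet q γ ψ n).indicator 1 x + 4 * ψ (q m) * ψ (q n) := by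
    intro x
    rw [hitDeviation, hitDeviation, Set.inter_indicator_one, Pi.mul_apply]
    ring
  have a0 := hi _ (hm.inter hn)
  have a1 := (hi _ hm).const_mul (2 * ψ (q n))
  have a2 := (hi _ hn).const_mul (2 * ψ (q m))
  have a01 : Integrable (fun x => (hitSet q γ ψ m ∩ hitSet q γ ψ n).indicator (1 : ℝ → ℝ) x -
    2 * ψ (q n) * (hitSet q γ ψ m).indicator 1 x) μ := a0.sub a1
  have a012 : Integrable (fun x => (hitSet q γ ψ m ∩ hitSet q γ ψ n).indicator (1 : ℝ → ℝ) x -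
    2 * ψ (q n) * (hitSet q γ ψ m).indicator 1 x -
    2 * ψ (q m) * (hitSet q γ ψ n).indicator 1 x) μ := a01.sub a2
  simp_rw [h]
  rw [integral_add a012 (integrable_const _), integral_sub a01 a2,
    integral_sub a0 a1, integral_const_mul, integral_const_mul, integral_const,
    integral_indicator_one hm, integral_indicator_one hn, integral_indicator_one (hm.inter hn)]
  simp

theorem sum_Ioc_pow_sub_le {θ : ℝ} (h0 : 0 < θ) (h1 : θ < 1) (a b : ℕ) :
    ∑ m ∈ Finset.Ioc a b, θ ^ (b + 1 - m) ≤ 1 / (1 - θ) := by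
  have h2 : 0 < 1 - θ := by linarith
  rcases le_or_gt b a with hba | hab
  · rw [Finset.Ioc_eq_empty (by omega), Finset.sum_empty]
    positivity
  -- The value `θ / (1 - θ)` is the fixed point of `s ↦ θ * s + θ`, the recursion for the sum, so
  -- the induction closes.
  have : ∑ m ∈ Finset.Ioc a b, θ ^ (b + 1 - m) ≤ θ / (1 - θ) := by
    induction b, hab.le using Nat.le_induction with
    | base => omega
    | succ b hb ih =>
      rw [Finset.sum_Ioc_succ_top (by omega)]
      have hs : ∑ m ∈ Finset.Ioc a b, θ ^ (b + 1 + 1 - m) =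
          θ * ∑ m ∈ Finset.Ioc a b, θ ^ (b + 1 - m) := by
        rw [Finset.mul_sum]
        refine Finset.sum_congr rfl fun m hm => ?_
        rw [Nat.succ_sub (by have := (Finset.mem_Ioc.1 hm).2; omega), pow_succ']
      have ih' : ∑ m ∈ Finset.Ioc a b, θ ^ (b + 1 - m) ≤ θ / (1 - θ) := by
        rcases hb.eq_or_lt with rfl | hb
        · simp only [Finset.Ioc_self, Finset.sum_empty]
          positivity
        · exact ih hb
      have hn : b + 1 + 1 - (b + 1) = 1 := by omega
      rw [hs, hn, pow_one]
      calc _ ≤ θ * (θ / (1 - θ)) + θ := by gcongr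
        _ = θ / (1 - θ) := by field_simp; ring
  refine this.trans ?_
  gcongr

/-- Quasi-independence of the sets `hitSet q γ ψ n`: the variance of the counting function over a
block is at most of the order of the block's mass. -/
theorem exists_variance_le {q : ℕ → ℝ} (hq : IsLacunary q) (γ : ℝ) {ψ : ℝ → ℝ}
    (hψ : ∀ t, ψ t ∈ Set.Ioo (0 : ℝ) 1) (hψ_half : ∀ n : ℕ, 1 ≤ n → ψ (q n) ≤ 1 / 2)
    (μ : Measure ℝ) [IsProbabilityMeasure μ]
    (hdecay : ∃ A : ℝ, 2 < A ∧
      Asymptotics.IsBigO (cocompact ℝ) (measureFourier μ) (fun t => Real.log |t| ^ (-A))) :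
    ∃ (φ : ℕ → ℝ) (B : ℝ), Summable φ ∧ 0 ≤ B ∧ (∀ n, 1 ≤ n → 0 ≤ φ n ∧ φ n ≤ 1) ∧
      (∀ n : ℕ, 1 ≤ n → μ.real (hitSet q γ ψ n) ≤ 2 * ψ (q n) + B * φ n) ∧
      ∀ a b : ℕ, ∫ x, (∑ n ∈ Finset.Ioc a b, hitDeviation q γ ψ n x) ^ 2 ∂μ ≤
        B * ∑ n ∈ Finset.Ioc a b, (ψ (q n) + φ n) := by
  obtain ⟨δ, θ, B, hδ, hθ0, hθ1, hB, h1, h2⟩ := exists_hitSet_bounds hq γ hψ hψ_half μ hdecay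
  have hsum : Summable fun n : ℕ => (n : ℝ) ^ (-(1 + δ)) := by
    rw [Real.summable_nat_rpow]; linarith
  have hsum2 : Summable fun n : ℕ => (n : ℝ) ^ (-(2 + δ)) := by
    rw [Real.summable_nat_rpow]; linarith
  obtain ⟨T, hT⟩ : ∃ T, T = ∑' n : ℕ, (n : ℝ) ^ (-(2 + δ)) := ⟨_, rfl⟩
  have hT0 : 0 ≤ T := hT ▸ tsum_nonneg fun n => by positivity
  have hG0 : 0 ≤ 1 / (1 - θ) := by
    have : 0 < 1 - θ := by linarith
    positivity
  have hτφ : ∀ n : ℕ, 1 ≤ n → (n : ℝ) ^ (-(2 + δ)) ≤ (n : ℝ) ^ (-(1 + δ)) := fun n hn =>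
    Real.rpow_le_rpow_of_exponent_le (by exact_mod_cast hn) (by linarith)
  have hcov : ∀ m n : ℕ, 1 ≤ m → m < n →
      ∫ x, hitDeviation q γ ψ m x * hitDeviation q γ ψ n x ∂μ ≤
        3 * B * (ψ (q n) * (θ ^ (n - m) + (m : ℝ) ^ (-(2 + δ))) + (n : ℝ) ^ (-(2 + δ))) := by
    intro m n hm hmn
    rw [integral_hitDeviation_mul]
    have e1 := h2 m n hm hmn
    have e2 := (abs_le.1 (h1 m hm)).1
    have e3 := (abs_le.1 (h1 n (hm.trans hmn.le))).1
    have hs0 := (hψ (q n)).1.le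
    have hp0 := (hψ (q m)).1.le
    have hp := hψ_half m hm
    have hτn0 : 0 ≤ (n : ℝ) ^ (-(2 + δ)) := by positivity
    have hτm0 : 0 ≤ (m : ℝ) ^ (-(2 + δ)) := by positivity
    have ht0 : 0 ≤ θ ^ (n - m) := by positivity
    generalize (n : ℝ) ^ (-(2 + δ)) = τn at *
    generalize (m : ℝ) ^ (-(2 + δ)) = τm at *
    generalize θ ^ (n - m) = t at *
    generalize ψ (q m) = p at *
    generalize ψ (q n) = s at *
    -- The four main terms `4 * p * s` cancel. The measures of the single sets enter with a minus
    -- sign, which is why lower bounds for them are needed.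
    have j1 := mul_le_mul_of_nonneg_left e2 hs0
    have j2 := mul_le_mul_of_nonneg_left e3 hp0
    have j3 : p * (B * τn) ≤ 1 / 2 * (B * τn) := by gcongr
    have j4 : 0 ≤ B * (s * t) := by positivity
    have j5 : 0 ≤ B * τn := by positivity
    nlinarith
  have hdiag : ∀ n : ℕ, 1 ≤ n → ∫ x, hitDeviation q γ ψ n x * hitDeviation q γ ψ n x ∂μ ≤
      4 * ψ (q n) + B * (n : ℝ) ^ (-(2 + δ)) := by
    intro n hn
    rw [integral_hitDeviation_mul, Set.inter_self]
    have e1 := (abs_le.1 (h1 n hn)).2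
    have hs0 := (hψ (q n)).1.le
    have hs := hψ_half n hn
    have hμ : 0 ≤ μ.real (hitSet q γ ψ n) := measureReal_nonneg
    nlinarith [mul_nonneg hs0 hμ]
  -- Adding one index to a block contributes twice a covariance sum with constant `3 * B`, and a
  -- diagonal term with constants `4` and `B`.
  obtain ⟨B', hB'⟩ : ∃ B', B' = 6 * B * (1 / (1 - θ) + T + 1) + 4 + B := ⟨_, rfl⟩
  have hBB' : B ≤ B' := by
    have : 0 ≤ 6 * B * (1 / (1 - θ) + T + 1) := by positivity
    linarith
  -- The error `n ^ (-(2 + δ))` occurs once for each `m < n`, which costs a factor at most `n` and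
  -- still leaves a summable sequence.
  refine ⟨fun n => (n : ℝ) ^ (-(1 + δ)), B', hsum, hB.trans hBB', ?_, ?_, ?_⟩
  · intro n hn
    exact ⟨by positivity,
      Real.rpow_le_one_of_one_le_of_nonpos (by exact_mod_cast hn) (by linarith)⟩
  · intro n hn
    have e1 := (abs_le.1 (h1 n hn)).2
    have : B * (n : ℝ) ^ (-(2 + δ)) ≤ B' * (n : ℝ) ^ (-(1 + δ)) :=
      mul_le_mul hBB' (hτφ n hn) (by positivity) (hB.trans hBB')
    linarith
  · intro a b
    have hmeas : ∀ n, AEStronglyMeasurable (hitDeviation q γ ψ n) μ := fun n =>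
      (measurable_hitDeviation q γ ψ n).aestronglyMeasurable
    have hint : ∀ m n, Integrable (fun x => hitDeviation q γ ψ m x * hitDeviation q γ ψ n x) μ := by
      intro m n
      refine Integrable.of_bound ((hmeas m).mul (hmeas n))
        ((1 + |2 * ψ (q m)|) * (1 + |2 * ψ (q n)|)) (Eventually.of_forall fun x => ?_)
      rw [norm_mul]
      exact mul_le_mul (abs_hitDeviation_le q γ ψ m x) (abs_hitDeviation_le q γ ψ n x)
        (abs_nonneg _) (by positivity)
    have hintsum : ∀ (s : Finset ℕ) n,
        Integrable (fun x => (∑ m ∈ s, hitDeviation q γ ψ m x) * hitDeviation q γ ψ n x) μ := by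
      intro s n
      simp_rw [Finset.sum_mul]
      exact integrable_finsetSum _ fun m _ => hint m n
    have hintsq : ∀ s : Finset ℕ,
        Integrable (fun x => (∑ m ∈ s, hitDeviation q γ ψ m x) ^ 2) μ := by
      intro s
      simp_rw [pow_two, Finset.mul_sum]
      exact integrable_finsetSum _ fun m _ => hintsum s m
    rcases le_total b a with hba | hab
    · rw [Finset.Ioc_eq_empty (by omega)]
      simp
    induction b, hab using Nat.le_induction with
    | base => simp
    | succ b hb ih =>
      simp_rw [Finset.sum_Ioc_succ_top hb]
      have hx : ∀ x, (∑ n ∈ Finset.Ioc a b, hitDeviation q γ ψ n x +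
          hitDeviation q γ ψ (b + 1) x) ^ 2 =
          (∑ n ∈ Finset.Ioc a b, hitDeviation q γ ψ n x) ^ 2 +
          2 * ((∑ n ∈ Finset.Ioc a b, hitDeviation q γ ψ n x) * hitDeviation q γ ψ (b + 1) x) +
          hitDeviation q γ ψ (b + 1) x * hitDeviation q γ ψ (b + 1) x := fun x => by ring
      simp_rw [hx]
      have a01 : Integrable (fun x => (∑ n ∈ Finset.Ioc a b, hitDeviation q γ ψ n x) ^ 2 +
          2 * ((∑ n ∈ Finset.Ioc a b, hitDeviation q γ ψ n x) * hitDeviation q γ ψ (b + 1) x)) μ :=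
        (hintsq _).add ((hintsum _ _).const_mul 2)
      beta_reduce at ih
      rw [integral_add a01 (hint _ _),
        integral_add (hintsq _) ((hintsum _ _).const_mul 2), integral_const_mul, mul_add B']
      have hcross : ∫ x, (∑ n ∈ Finset.Ioc a b, hitDeviation q γ ψ n x) *
          hitDeviation q γ ψ (b + 1) x ∂μ ≤
          3 * B * (ψ (q (b + 1)) * (1 / (1 - θ) + T) + ((b + 1 : ℕ) : ℝ) ^ (-(1 + δ))) := by
        simp_rw [Finset.sum_mul]
        rw [integral_finsetSum _ fun m _ => hint m (b + 1)]
        calc _ ≤ ∑ m ∈ Finset.Ioc a b, 3 * B * (ψ (q (b + 1)) * (θ ^ (b + 1 - m) +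
              (m : ℝ) ^ (-(2 + δ))) + ((b + 1 : ℕ) : ℝ) ^ (-(2 + δ))) := by
              refine Finset.sum_le_sum fun m hm => ?_
              obtain ⟨i1, i2⟩ := Finset.mem_Ioc.1 hm
              exact hcov m (b + 1) (by omega) (by omega)
          _ = 3 * B * (ψ (q (b + 1)) * (∑ m ∈ Finset.Ioc a b, θ ^ (b + 1 - m) +
              ∑ m ∈ Finset.Ioc a b, (m : ℝ) ^ (-(2 + δ))) +
              ∑ m ∈ Finset.Ioc a b, ((b + 1 : ℕ) : ℝ) ^ (-(2 + δ))) := by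
              rw [← Finset.mul_sum, Finset.sum_add_distrib, ← Finset.mul_sum,
                Finset.sum_add_distrib]
          _ ≤ _ := by
              have hs0 := (hψ (q (b + 1))).1.le
              gcongr
              · exact sum_Ioc_pow_sub_le hθ0 hθ1 a b
              · rw [hT]
                exact hsum2.sum_le_tsum _ fun n _ => by positivity
              · rw [Finset.sum_const, nsmul_eq_mul, Nat.card_Ioc]
                have hpos : (0 : ℝ) < ((b + 1 : ℕ) : ℝ) := by positivity
                have hle : ((b - a : ℕ) : ℝ) ≤ ((b + 1 : ℕ) : ℝ) := by
                  exact_mod_cast (by omega : b - a ≤ b + 1)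
                calc _ ≤ ((b + 1 : ℕ) : ℝ) * ((b + 1 : ℕ) : ℝ) ^ (-(2 + δ)) := by gcongr
                  _ = ((b + 1 : ℕ) : ℝ) ^ (1 + -(2 + δ)) := by
                    rw [Real.rpow_add hpos, Real.rpow_one]
                  _ = _ := by congr 1; ring
      have hd := hdiag (b + 1) (by omega)
      have hτ := mul_le_mul_of_nonneg_left (hτφ (b + 1) (by omega)) hB
      have hs0 := (hψ (q (b + 1))).1.le
      have hφ0 : 0 ≤ ((b + 1 : ℕ) : ℝ) ^ (-(1 + δ)) := by positivity
      generalize ψ (q (b + 1)) = s at *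
      generalize ((b + 1 : ℕ) : ℝ) ^ (-(1 + δ)) = f at *
      have k1 : 0 ≤ B * s := by positivity
      have k2 : 0 ≤ B * (1 / (1 - θ) + T) * f := by positivity
      rw [hB']
      rw [hB'] at ih
      nlinarith

/-! ### Dyadic chaining: from second moments to almost sure bounds. -/

/-- The sum of the squared increments of `F` over the dyadic blocks of length `2 ^ s`, `s < r`,
contained in `[0, 2 ^ r]`. -/
noncomputable def dyadicEnergy (F : ℕ → ℝ) (r : ℕ) : ℝ :=
  ∑ s ∈ Finset.range r, ∑ u ∈ Finset.range (2 ^ (r - s)), (F ((u + 1) * 2 ^ s) - F (u * 2 ^ s)) ^ 2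

theorem dyadicEnergy_nonneg (F : ℕ → ℝ) (r : ℕ) : 0 ≤ dyadicEnergy F r :=
  Finset.sum_nonneg fun _ _ => Finset.sum_nonneg fun _ _ => sq_nonneg _

/-- The dyadic chaining inequality of Rademacher and Menshov. -/
theorem sq_sub_le_mul_dyadicEnergy (F : ℕ → ℝ) {j r : ℕ} (hj : j < 2 ^ r) :
    (F j - F 0) ^ 2 ≤ r * dyadicEnergy F r := by
  -- Clear the binary digits of `j` one at a time from the lowest. A digit `0` gives no increment
  -- and a digit `1` gives exactly one dyadic block; Cauchy–Schwarz over the `r` digits does the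
  -- rest.
  have h1 : F j - F 0 = ∑ s ∈ Finset.range r,
      (F (j / 2 ^ s * 2 ^ s) - F (j / 2 ^ (s + 1) * 2 ^ (s + 1))) := by
    rw [Finset.sum_range_sub' fun s => F (j / 2 ^ s * 2 ^ s)]
    simp [Nat.div_eq_of_lt hj]
  rw [h1]
  refine sq_sum_le_card_mul_sum_sq.trans ?_
  rw [Finset.card_range, dyadicEnergy]
  refine mul_le_mul_of_nonneg_left (Finset.sum_le_sum fun s hs => ?_) (by positivity)
  have hs' := Finset.mem_range.1 hs
  have hdiv : j / 2 ^ (s + 1) = j / 2 ^ s / 2 := by rw [pow_succ, Nat.div_div_eq_div_mul]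
  have hlt : j / 2 ^ s < 2 ^ (r - s) := by
    rw [Nat.div_lt_iff_lt_mul (by positivity), ← pow_add, Nat.sub_add_cancel hs'.le]
    exact hj
  rw [hdiv, show 2 ^ (s + 1) = 2 * 2 ^ s by ring, ← mul_assoc]
  generalize j / 2 ^ s = v at *
  rcases Nat.even_or_odd' v with ⟨w, rfl | rfl⟩
  · rw [Nat.mul_div_cancel_left _ two_pos, mul_comm w 2, sub_self]
    have : (0 : ℝ) ^ 2 = 0 := by norm_num
    rw [this]
    exact Finset.sum_nonneg fun _ _ => sq_nonneg _
  · have : (2 * w + 1) / 2 = w := by omega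
    rw [this, mul_comm w 2]
    exact Finset.single_le_sum (f := fun u => (F ((u + 1) * 2 ^ s) - F (u * 2 ^ s)) ^ 2)
      (fun _ _ => sq_nonneg _) (Finset.mem_range.2 (by omega : 2 * w < 2 ^ (r - s)))

/-- At each of the `r` scales the blocks tile `[0, 2 ^ r]`, so the bounds telescope to the total
weight. -/
theorem integral_dyadicEnergy_le {Ω : Type*} [MeasurableSpace Ω] {μ : Measure Ω}
    {F : ℕ → Ω → ℝ} {w : ℕ → ℝ} {B : ℝ}
    (hint : ∀ u v, Integrable (fun x => (F v x - F u x) ^ 2) μ)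
    (hF : ∀ u v, u ≤ v → ∫ x, (F v x - F u x) ^ 2 ∂μ ≤ B * (w v - w u)) (r : ℕ) :
    Integrable (fun x => dyadicEnergy (fun j => F j x) r) μ ∧
      ∫ x, dyadicEnergy (fun j => F j x) r ∂μ ≤ r * (B * (w (2 ^ r) - w 0)) := by
  unfold dyadicEnergy
  refine ⟨integrable_finsetSum _ fun s _ => integrable_finsetSum _ fun u _ => hint _ _, ?_⟩
  rw [integral_finsetSum _ fun s _ => integrable_finsetSum _ fun u _ => hint _ _]
  have : ∀ s ∈ Finset.range r, ∫ x, ∑ u ∈ Finset.range (2 ^ (r - s)),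
      (F ((u + 1) * 2 ^ s) x - F (u * 2 ^ s) x) ^ 2 ∂μ ≤ B * (w (2 ^ r) - w 0) := by
    intro s hs
    rw [integral_finsetSum _ fun u _ => hint _ _]
    refine (Finset.sum_le_sum fun u _ => hF _ _ (Nat.mul_le_mul_right _ u.le_succ)).trans ?_
    rw [← Finset.mul_sum, Finset.sum_range_sub fun u => w (u * 2 ^ s), ← pow_add,
      Nat.sub_add_cancel (Finset.mem_range.1 hs).le, zero_mul]
  refine (Finset.sum_le_sum this).trans ?_
  simp

/-- The Gál–Koksma argument: a second-moment bound for all increments gives an almost sure bound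
of order `j ^ (1 / 2) * (log j) ^ (3 / 2 + ε)`. -/
theorem ae_exists_abs_sub_le {Ω : Type*} [MeasurableSpace Ω] {μ : Measure Ω}
    {F : ℕ → Ω → ℝ} {w : ℕ → ℝ} {B : ℝ} (hB : 0 ≤ B)
    (hint : ∀ u v, Integrable (fun x => (F v x - F u x) ^ 2) μ)
    (hF : ∀ u v, u ≤ v → ∫ x, (F v x - F u x) ^ 2 ∂μ ≤ B * (w v - w u))
    (hw0 : 0 ≤ w 0) (hw : ∀ j, w j ≤ j + 2) {ε : ℝ} (hε : 0 < ε) :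
    ∀ᵐ x ∂μ, ∃ K : ℝ, 0 ≤ K ∧ ∀ j : ℕ, 1 ≤ j →
      |F j x - F 0 x| ≤ K * ((j : ℝ) ^ (1 / 2 : ℝ) * Real.log (j + 2) ^ (3 / 2 + ε)) := by
  have hE := integral_dyadicEnergy_le hint hF
  -- The expected energy is `O(r * 2 ^ r)`, so this is a normalisation whose quotients have summable
  -- expectations. The sum over `r` is then finite almost everywhere, and its value bounds every
  -- quotient.
  obtain ⟨d, hd⟩ : ∃ d : ℕ → ℝ, ∀ r, d r = 2 ^ r * ((r + 1 : ℕ) : ℝ) ^ (2 + 2 * ε) :=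
    ⟨_, fun r => rfl⟩
  have hd0 : ∀ r, 0 < d r := fun r => by rw [hd]; positivity
  have hbound : ∀ r, ∫ x, dyadicEnergy (fun j => F j x) r / d r ∂μ ≤
      3 * B * ((r + 1 : ℕ) : ℝ) ^ (-(1 + 2 * ε)) := by
    intro r
    rw [integral_div, div_le_iff₀ (hd0 r)]
    refine (hE r).2.trans ?_
    have h1 : w (2 ^ r) - w 0 ≤ 3 * 2 ^ r := by
      have e1 := hw (2 ^ r)
      push_cast at e1
      have e2 : (1 : ℝ) ≤ 2 ^ r := one_le_pow₀ (by norm_num)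
      linarith
    have hr : (r : ℝ) ≤ ((r + 1 : ℕ) : ℝ) := by push_cast; linarith
    have hp : (0 : ℝ) < ((r + 1 : ℕ) : ℝ) := by positivity
    calc (r : ℝ) * (B * (w (2 ^ r) - w 0)) ≤ r * (B * (3 * 2 ^ r)) := by gcongr
      _ ≤ ((r + 1 : ℕ) : ℝ) * (B * (3 * 2 ^ r)) := by gcongr
      _ = 3 * B * (2 ^ r * ((r + 1 : ℕ) : ℝ) ^ (-(1 + 2 * ε) + (2 + 2 * ε))) := by
          rw [show -(1 + 2 * ε) + (2 + 2 * ε) = 1 by ring, Real.rpow_one]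
          ring
      _ = _ := by
          rw [Real.rpow_add hp, hd]
          ring
  have hsum : Summable fun r : ℕ => 3 * B * ((r + 1 : ℕ) : ℝ) ^ (-(1 + 2 * ε)) := by
    have h : Summable fun r : ℕ => (r : ℝ) ^ (-(1 + 2 * ε)) := by
      rw [Real.summable_nat_rpow]
      linarith
    exact ((summable_nat_add_iff (f := fun r : ℕ => (r : ℝ) ^ (-(1 + 2 * ε))) 1).2 h).mul_left _
  have hEint : ∀ r, Integrable (fun x => dyadicEnergy (fun j => F j x) r / d r) μ :=
    fun r => (hE r).1.div_const (d r)
  have hEnn : ∀ r x, 0 ≤ dyadicEnergy (fun j => F j x) r / d r := fun r x =>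
    div_nonneg (dyadicEnergy_nonneg _ _) (hd0 r).le
  have hae : ∀ᵐ x ∂μ, ∑' r, ENNReal.ofReal (dyadicEnergy (fun j => F j x) r / d r) < ⊤ := by
    have hmeas : ∀ r, AEMeasurable
        (fun x => ENNReal.ofReal (dyadicEnergy (fun j => F j x) r / d r)) μ := fun r =>
      (hEint r).aestronglyMeasurable.aemeasurable.ennreal_ofReal
    refine ae_lt_top' (AEMeasurable.tsum hmeas) (ne_of_lt ?_)
    rw [lintegral_tsum hmeas]
    refine lt_of_le_of_lt (ENNReal.tsum_le_tsum fun r => ?_) (hsum.tsum_ofReal_lt_top)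
    rw [← ofReal_integral_eq_lintegral_ofReal (hEint r) (Eventually.of_forall (hEnn r))]
    exact ENNReal.ofReal_le_ofReal (hbound r)
  filter_upwards [hae] with x hx
  obtain ⟨S, hS⟩ : ∃ S, S = (∑' r, ENNReal.ofReal (dyadicEnergy (fun j => F j x) r / d r)).toReal :=
    ⟨_, rfl⟩
  have hS0 : 0 ≤ S := hS ▸ ENNReal.toReal_nonneg
  have hSr : ∀ r, dyadicEnergy (fun j => F j x) r ≤ S * d r := by
    intro r
    rw [← div_le_iff₀ (hd0 r), hS]
    refine (ENNReal.ofReal_le_iff_le_toReal hx.ne).1 ?_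
    exact ENNReal.le_tsum r
  -- The `2` comes from `2 ^ r ≤ 2 * j` and the `4` from `r + 1 ≤ 4 * log (j + 2)`.
  refine ⟨√(2 * S) * 4 ^ (3 / 2 + ε), by positivity, fun j hj => ?_⟩
  obtain ⟨r, hr⟩ : ∃ r, r = Nat.log 2 j + 1 := ⟨_, rfl⟩
  have hjr : j < 2 ^ r := hr ▸ Nat.lt_pow_succ_log_self one_lt_two j
  have hrj : 2 ^ r ≤ 2 * j := by
    rw [hr, pow_succ, mul_comm]
    exact Nat.mul_le_mul_left 2 (Nat.pow_log_le_self 2 (by omega))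
  have hj' : (1 : ℝ) ≤ j := by exact_mod_cast hj
  have hlog1 : 1 ≤ Real.log (j + 2) := by
    rw [Real.le_log_iff_exp_le (by linarith)]
    linarith [Real.exp_one_lt_d9]
  have hrlog : ((r + 1 : ℕ) : ℝ) ≤ 4 * Real.log (j + 2) := by
    have h1 : ((Nat.log 2 j : ℕ) : ℝ) * Real.log 2 ≤ Real.log (j + 2) := by
      rw [← Real.log_pow]
      refine Real.log_le_log (by positivity) ?_
      have : ((2 ^ Nat.log 2 j : ℕ) : ℝ) ≤ j := by
        exact_mod_cast Nat.pow_log_le_self 2 (by omega : j ≠ 0)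
      push_cast at this
      linarith
    have h2 := Real.log_two_gt_d9
    have h3 : (0 : ℝ) ≤ Nat.log 2 j := by positivity
    rw [hr]
    push_cast
    nlinarith
  have hmain := sq_sub_le_mul_dyadicEnergy (fun j => F j x) hjr
  have hL0 : 0 ≤ Real.log (j + 2) := by linarith
  refine abs_le_of_sq_le_sq ?_ (by positivity)
  calc _ ≤ (r : ℝ) * dyadicEnergy (fun j => F j x) r := hmain
    _ ≤ ((r + 1 : ℕ) : ℝ) * (S * (2 ^ r * ((r + 1 : ℕ) : ℝ) ^ (2 + 2 * ε))) := by
        rw [← hd]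
        have := hSr r
        have h0 := dyadicEnergy_nonneg (fun j => F j x) r
        gcongr
        simp
    _ = S * 2 ^ r * ((r + 1 : ℕ) : ℝ) ^ (1 + (2 + 2 * ε)) := by
        rw [Real.rpow_add (by positivity) 1, Real.rpow_one]
        ring
    _ ≤ S * (2 * j) * (4 * Real.log (j + 2)) ^ (1 + (2 + 2 * ε)) := by
        have : (2 : ℝ) ^ r ≤ 2 * j := by exact_mod_cast hrj
        gcongr
    _ = _ := by
        have e : 1 + (2 + 2 * ε) = (3 / 2 + ε) * 2 := by ring
        rw [e, Real.rpow_mul (by positivity), Real.mul_rpow (by norm_num) hL0, mul_pow, mul_pow,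
          mul_pow, Real.sq_sqrt (by positivity), ← Real.sqrt_eq_rpow, Real.sq_sqrt (by linarith)]
        have e2 : ∀ y : ℝ, y ^ (2 : ℝ) = y ^ 2 := fun y => Real.rpow_two y
        simp only [e2]
        ring

/-! ### The counting function when the total mass is bounded, and when it is not. -/

theorem countR_eq_sum (q : ℕ → ℝ) (γ : ℝ) (ψ : ℝ → ℝ) (x : ℝ) (N : ℕ) :
    (countR q γ ψ x N : ℝ) = ∑ n ∈ Finset.Ioc 0 N, (hitSet q γ ψ n).indicator 1 x := by
  classical
  have h : {n : ℕ | 1 ≤ n ∧ n ≤ N ∧ distNearestInt (q n * x - γ) ≤ ψ (q n)} =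
      ((Finset.Ioc 0 N).filter fun n => distNearestInt (q n * x - γ) ≤ ψ (q n) : Finset ℕ) := by
    ext n
    simp [Nat.succ_le_iff, and_assoc]
  rw [countR, h, Set.ncard_coe_finset, ← Finset.sum_boole]
  exact Finset.sum_congr rfl fun n _ => (indicator_hitSet q γ ψ n x).symm

theorem countR_mono (q : ℕ → ℝ) (γ : ℝ) (ψ : ℝ → ℝ) (x : ℝ) : Monotone (countR q γ ψ x) := by
  intro M N h
  refine Set.ncard_le_ncard (fun n hn => ⟨hn.1, hn.2.1.trans h, hn.2.2⟩) ?_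
  exact (Set.finite_Icc 1 N).subset fun n hn => ⟨hn.1, hn.2.1⟩

theorem sumPsi_eq_sum_Ioc (q : ℕ → ℝ) (ψ : ℝ → ℝ) (N : ℕ) :
    sumPsi q ψ N = ∑ n ∈ Finset.Ioc 0 N, ψ (q n) := rfl

theorem countR_sub_eq_sum (q : ℕ → ℝ) (γ : ℝ) (ψ : ℝ → ℝ) (x : ℝ) (N : ℕ) :
    (countR q γ ψ x N : ℝ) - 2 * sumPsi q ψ N =
      ∑ n ∈ Finset.Ioc 0 N, hitDeviation q γ ψ n x := by
  rw [countR_eq_sum, sumPsi_eq_sum_Ioc, Finset.mul_sum, ← Finset.sum_sub_distrib]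
  rfl

/-- Allows the error rate to be passed from the auxiliary mass to `sumPsi`, which is comparable to
it. The `2` inside the logarithm keeps it at least `log 2`, so `log c` is absorbed multiplicatively.
-/
theorem rpow_mul_log_rpow_le {c p y z : ℝ} (hc : 1 ≤ c) (hp : 0 ≤ p) (hy : 0 ≤ y) (hz : 0 ≤ z)
    (hzy : z ≤ c * y) :
    z ^ (1 / 2 : ℝ) * Real.log (z + 2) ^ p ≤
      c ^ (1 / 2 : ℝ) * (Real.log c / Real.log 2 + 1) ^ p *
        (y ^ (1 / 2 : ℝ) * Real.log (y + 2) ^ p) := by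
  have hl2 : 0 < Real.log 2 := Real.log_pos (by norm_num)
  have hlc : 0 ≤ Real.log c := Real.log_nonneg hc
  have hly : Real.log 2 ≤ Real.log (y + 2) := Real.log_le_log (by norm_num) (by linarith)
  have h1 : Real.log (z + 2) ≤ (Real.log c / Real.log 2 + 1) * Real.log (y + 2) := by
    calc Real.log (z + 2) ≤ Real.log (c * (y + 2)) :=
          Real.log_le_log (by linarith) (by nlinarith)
      _ = Real.log c / Real.log 2 * Real.log 2 + Real.log (y + 2) := by
          rw [Real.log_mul (by linarith) (by linarith)]
          field_simp
      _ ≤ Real.log c / Real.log 2 * Real.log (y + 2) + Real.log (y + 2) := by gcongr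
      _ = _ := by ring
  have hlz : 0 ≤ Real.log (z + 2) := Real.log_nonneg (by linarith)
  calc _ ≤ (c * y) ^ (1 / 2 : ℝ) *
        ((Real.log c / Real.log 2 + 1) * Real.log (y + 2)) ^ p := by gcongr
    _ = _ := by
      rw [Real.mul_rpow (by linarith) hy, Real.mul_rpow (by positivity) (by linarith)]
      ring

theorem sumPsi_mono {q : ℕ → ℝ} {ψ : ℝ → ℝ} (hψ : ∀ t, ψ t ∈ Set.Ioo (0 : ℝ) 1) :
    Monotone (sumPsi q ψ) := fun _ _ h =>
  Finset.sum_le_sum_of_subset_of_nonneg (Finset.Icc_subset_Icc_right h) fun _ _ _ => (hψ _).1.le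

theorem le_sumPsi {q : ℕ → ℝ} {ψ : ℝ → ℝ} (hψ : ∀ t, ψ t ∈ Set.Ioo (0 : ℝ) 1) {N : ℕ}
    (hN : 1 ≤ N) : ψ (q 1) ≤ sumPsi q ψ N := by
  have : sumPsi q ψ 1 = ψ (q 1) := by simp [sumPsi]
  rw [← this]
  exact sumPsi_mono hψ hN

theorem countR_sub_zero (q : ℕ → ℝ) (γ : ℝ) (ψ : ℝ → ℝ) (x : ℝ) :
    (countR q γ ψ x 0 : ℝ) - 2 * sumPsi q ψ 0 = 0 := by
  rw [countR_sub_eq_sum]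
  simp

/-- The convergence case, by the Borel–Cantelli lemma. -/
theorem ae_exists_countR_le_of_bddAbove {q : ℕ → ℝ} {γ : ℝ} {ψ : ℝ → ℝ}
    (hψ : ∀ t, ψ t ∈ Set.Ioo (0 : ℝ) 1) {μ : Measure ℝ} [IsProbabilityMeasure μ]
    {φ : ℕ → ℝ} {B : ℝ} (hφ : Summable φ)
    (hμ : ∀ n : ℕ, 1 ≤ n → μ.real (hitSet q γ ψ n) ≤ 2 * ψ (q n) + B * φ n)
    {M : ℝ} (hM : ∀ N, sumPsi q ψ N ≤ M) {p : ℝ} (hp : 0 ≤ p) :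
    ∀ᵐ x ∂μ, ∃ K : ℝ, ∀ N : ℕ, |(countR q γ ψ x N : ℝ) - 2 * sumPsi q ψ N| ≤
      K * (sumPsi q ψ N ^ (1 / 2 : ℝ) * Real.log (sumPsi q ψ N + 2) ^ p) := by
  have hsψ : Summable fun n => ψ (q (n + 1)) := by
    refine summable_of_sum_range_le (c := M) (fun n => (hψ _).1.le) fun N => ?_
    refine le_of_eq_of_le ?_ (hM N)
    rw [sumPsi, Finset.sum_bij (fun n _ => n + 1)]
    · intro n hn
      simpa using hn
    · intro m _ n _ h
      simpa using h
    · intro n hn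
      obtain ⟨h1, h2⟩ := Finset.mem_Icc.1 hn
      exact ⟨n - 1, Finset.mem_range.2 (by omega), by omega⟩
    · intro n _
      rfl
  have hs : Summable fun n => 2 * ψ (q (n + 1)) + B * φ (n + 1) :=
    (hsψ.mul_left 2).add (((summable_nat_add_iff (f := φ) 1).2 hφ).mul_left B)
  have hfin : ∑' n, μ (hitSet q γ ψ (n + 1)) ≠ ⊤ := by
    refine ne_top_of_le_ne_top hs.tsum_ofReal_ne_top (ENNReal.tsum_le_tsum fun n => ?_)
    rw [← ofReal_measureReal]
    exact ENNReal.ofReal_le_ofReal (hμ (n + 1) (by omega))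
  filter_upwards [ae_eventually_notMem hfin] with x hx
  obtain ⟨n₁, hn₁⟩ := eventually_atTop.1 hx
  have hc : ∀ N, countR q γ ψ x N ≤ n₁ := by
    intro N
    have hsub : {n : ℕ | 1 ≤ n ∧ n ≤ N ∧ distNearestInt (q n * x - γ) ≤ ψ (q n)} ⊆
        (Finset.Icc 1 n₁ : Finset ℕ) := by
      rintro n ⟨h1, -, h3⟩
      rw [Finset.coe_Icc]
      refine ⟨h1, ?_⟩
      by_contra h
      refine hn₁ (n - 1) (by omega) ?_
      rw [Nat.sub_add_cancel h1]
      exact h3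
    refine (Set.ncard_le_ncard hsub (Finset.finite_toSet _)).trans ?_
    rw [Set.ncard_coe_finset]
    simp
  have hl2 : 0 < Real.log 2 := Real.log_pos (by norm_num)
  have hψ1 := (hψ (q 1)).1
  have hκ : 0 < ψ (q 1) ^ (1 / 2 : ℝ) * Real.log 2 ^ p := by positivity
  -- The left side is bounded, and for `N ≥ 1` the rate is at least this denominator, which is
  -- positive because `ψ (q 1) > 0`. For `N = 0` both sides vanish.
  refine ⟨(n₁ + 2 * M) / (ψ (q 1) ^ (1 / 2 : ℝ) * Real.log 2 ^ p), fun N => ?_⟩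
  rcases Nat.eq_zero_or_pos N with rfl | hN
  · rw [countR_sub_zero]
    have : sumPsi q ψ 0 = 0 := by simp [sumPsi]
    rw [this, Real.zero_rpow (by norm_num)]
    simp
  have h1 := le_sumPsi (q := q) hψ hN
  have h2 : (countR q γ ψ x N : ℝ) ≤ n₁ := by exact_mod_cast hc N
  have h3 := hM N
  have h4 : (0 : ℝ) ≤ countR q γ ψ x N := by positivity
  have hK : 0 ≤ (n₁ : ℝ) + 2 * M := by linarith
  have hle : ψ (q 1) ^ (1 / 2 : ℝ) * Real.log 2 ^ p ≤
      sumPsi q ψ N ^ (1 / 2 : ℝ) * Real.log (sumPsi q ψ N + 2) ^ p := by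
    have : Real.log 2 ≤ Real.log (sumPsi q ψ N + 2) :=
      Real.log_le_log (by norm_num) (by linarith)
    gcongr
    exact Real.rpow_nonneg (by linarith) _
  calc _ ≤ (n₁ : ℝ) + 2 * M := by rw [abs_le]; constructor <;> linarith
    _ = (n₁ + 2 * M) / (ψ (q 1) ^ (1 / 2 : ℝ) * Real.log 2 ^ p) *
        (ψ (q 1) ^ (1 / 2 : ℝ) * Real.log 2 ^ p) := by field_simp
    _ ≤ _ := by gcongr

/-- Chaining over `n` itself would give a rate in `N`. Chaining along times at which the mass `Φ`
passes successive integers gives a rate in the mass; unboundedness makes all these times finite. -/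
theorem ae_exists_countR_le_of_not_bddAbove {q : ℕ → ℝ} {γ : ℝ} {ψ : ℝ → ℝ}
    (hψ : ∀ t, ψ t ∈ Set.Ioo (0 : ℝ) 1) {μ : Measure ℝ} [IsProbabilityMeasure μ]
    {φ : ℕ → ℝ} {B : ℝ} (hB : 0 ≤ B) (hφ : Summable φ) (hφ1 : ∀ n, 1 ≤ n → 0 ≤ φ n ∧ φ n ≤ 1)
    (hvar : ∀ a b : ℕ, ∫ x, (∑ n ∈ Finset.Ioc a b, hitDeviation q γ ψ n x) ^ 2 ∂μ ≤
        B * ∑ n ∈ Finset.Ioc a b, (ψ (q n) + φ n))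
    (hM : ∀ M, ∃ N, M ≤ sumPsi q ψ N) {ε : ℝ} (hε : 0 < ε) :
    ∀ᵐ x ∂μ, ∃ K : ℝ, ∀ N : ℕ, |(countR q γ ψ x N : ℝ) - 2 * sumPsi q ψ N| ≤
      K * (sumPsi q ψ N ^ (1 / 2 : ℝ) * Real.log (sumPsi q ψ N + 2) ^ (3 / 2 + ε)) := by
  classical
  obtain ⟨Φ, hΦ⟩ : ∃ Φ : ℕ → ℝ, ∀ N, Φ N = ∑ n ∈ Finset.Ioc 0 N, (ψ (q n) + φ n) :=
    ⟨_, fun _ => rfl⟩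
  have hΦ0 : Φ 0 = 0 := by simp [hΦ]
  have hφΦ : ∀ N, Φ N = sumPsi q ψ N + ∑ n ∈ Finset.Ioc 0 N, φ n := fun N => by
    rw [hΦ, sumPsi_eq_sum_Ioc, Finset.sum_add_distrib]
  have hφs0 : ∀ N, 0 ≤ ∑ n ∈ Finset.Ioc 0 N, φ n := fun N =>
    Finset.sum_nonneg fun n hn => (hφ1 n (Finset.mem_Ioc.1 hn).1).1
  have hφmono : Monotone fun N => ∑ n ∈ Finset.Ioc 0 N, φ n := fun a b h =>
    Finset.sum_le_sum_of_subset_of_nonneg (Finset.Ioc_subset_Ioc_right h) fun n hn _ =>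
      (hφ1 n (Finset.mem_Ioc.1 hn).1).1
  have hΦmono : Monotone Φ := fun a b h => by
    rw [hφΦ, hφΦ]
    exact add_le_add (sumPsi_mono hψ h) (hφmono h)
  have hψΦ : ∀ a b, a ≤ b → sumPsi q ψ b - sumPsi q ψ a ≤ Φ b - Φ a := fun a b h => by
    rw [hφΦ, hφΦ]
    have := hφmono h
    simp only at this
    linarith
  have hΦsucc : ∀ N, Φ (N + 1) ≤ Φ N + 2 := fun N => by
    rw [hΦ, hΦ, Finset.sum_Ioc_succ_top (Nat.zero_le N)]
    have := (hφ1 (N + 1) (by omega)).2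
    have := (hψ (q (N + 1))).2
    linarith
  have hex : ∀ j : ℕ, ∃ N, (j : ℝ) ≤ Φ N := fun j => by
    obtain ⟨N, hN⟩ := hM j
    exact ⟨N, by rw [hφΦ]; linarith [hφs0 N]⟩
  -- `t j` is the first index at which `Φ` reaches `j`. As each step of `Φ` is at most `2`, the
  -- overshoot is bounded: `Φ (t j) ≤ j + 2`.
  obtain ⟨t, ht1, ht2⟩ : ∃ t : ℕ → ℕ, (∀ j : ℕ, (j : ℝ) ≤ Φ (t j)) ∧
      ∀ (j N : ℕ), (j : ℝ) ≤ Φ N → t j ≤ N :=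
    ⟨fun j => Nat.find (hex j), fun j => Nat.find_spec (hex j),
      fun j N h => Nat.find_min' (hex j) h⟩
  have ht0 : t 0 = 0 := Nat.le_zero.1 (ht2 0 0 (by rw [hΦ0]; simp))
  have htmono : Monotone t := fun i j h =>
    ht2 i _ (le_trans (by exact_mod_cast h) (ht1 j))
  have htle : ∀ j : ℕ, Φ (t j) ≤ j + 2 := by
    intro j
    rcases Nat.eq_zero_or_pos (t j) with h | h
    · rw [h, hΦ0]
      positivity
    · have h1 : Φ (t j - 1) < j := by
        by_contra hc
        have := ht2 j _ (not_lt.1 hc)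
        omega
      have h2 := hΦsucc (t j - 1)
      rw [Nat.sub_add_cancel h] at h2
      linarith
  have hdiff : ∀ u v, u ≤ v → ∀ x, ∑ n ∈ Finset.Ioc 0 (t v), hitDeviation q γ ψ n x -
      ∑ n ∈ Finset.Ioc 0 (t u), hitDeviation q γ ψ n x =
      ∑ n ∈ Finset.Ioc (t u) (t v), hitDeviation q γ ψ n x := by
    intro u v h x
    rw [← Finset.sum_Ioc_consecutive _ (Nat.zero_le _) (htmono h), add_sub_cancel_left]
  have hdiffΦ : ∀ u v, u ≤ v → ∑ n ∈ Finset.Ioc (t u) (t v), (ψ (q n) + φ n) =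
      Φ (t v) - Φ (t u) := by
    intro u v h
    rw [hΦ, hΦ, ← Finset.sum_Ioc_consecutive _ (Nat.zero_le _) (htmono h), add_sub_cancel_left]
  have hint : ∀ u v, Integrable (fun x => (∑ n ∈ Finset.Ioc 0 (t v), hitDeviation q γ ψ n x -
      ∑ n ∈ Finset.Ioc 0 (t u), hitDeviation q γ ψ n x) ^ 2) μ := by
    intro u v
    have hmeas : ∀ s : Finset ℕ, Measurable fun x => ∑ n ∈ s, hitDeviation q γ ψ n x := fun s =>
      Finset.measurable_fun_sum s fun n _ => measurable_hitDeviation q γ ψ n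
    have hb : ∀ (s : Finset ℕ) x, |∑ n ∈ s, hitDeviation q γ ψ n x| ≤
        ∑ n ∈ s, (1 + |2 * ψ (q n)|) := fun s x =>
      (Finset.abs_sum_le_sum_abs _ _).trans
        (Finset.sum_le_sum fun n _ => abs_hitDeviation_le q γ ψ n x)
    refine Integrable.of_bound (((hmeas _).sub (hmeas _)).pow_const 2).aestronglyMeasurable
      ((∑ n ∈ Finset.Ioc 0 (t v), (1 + |2 * ψ (q n)|) +
        ∑ n ∈ Finset.Ioc 0 (t u), (1 + |2 * ψ (q n)|)) ^ 2) (Eventually.of_forall fun x => ?_)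
    rw [norm_pow]
    refine pow_le_pow_left₀ (norm_nonneg _) ?_ 2
    exact (abs_sub _ _).trans (add_le_add (hb _ x) (hb _ x))
  have hmain := ae_exists_abs_sub_le (μ := μ)
    (F := fun j x => ∑ n ∈ Finset.Ioc 0 (t j), hitDeviation q γ ψ n x) (w := fun j => Φ (t j)) hB
    hint (fun u v h => by
      simp only [hdiff u v h, ← hdiffΦ u v h]
      exact hvar _ _)
    (by simp only [ht0, hΦ0, le_refl]) htle hε
  have hψ1 := (hψ (q 1)).1
  have hT0 : 0 ≤ ∑' n, φ (n + 1) := tsum_nonneg fun n => (hφ1 (n + 1) (by omega)).1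
  have hφT : ∀ N, ∑ n ∈ Finset.Ioc 0 N, φ n ≤ ∑' n, φ (n + 1) := by
    intro N
    have h1 : ∑ n ∈ Finset.Ioc 0 N, φ n = ∑ n ∈ Finset.range N, φ (n + 1) := by
      induction N with
      | zero => simp
      | succ N ih => rw [Finset.sum_Ioc_succ_top (Nat.zero_le N), Finset.sum_range_succ, ih]
    rw [h1]
    exact ((summable_nat_add_iff (f := φ) 1).2 hφ).sum_le_tsum _ fun n _ =>
      (hφ1 (n + 1) (by omega)).1
  -- Chosen so that `j + 1 ≤ Φ N + 1 ≤ c * sumPsi q ψ N`: the bounded excess of `Φ` over `sumPsi` is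
  -- paid for by `sumPsi q ψ N ≥ ψ (q 1)`.
  obtain ⟨c, hc⟩ : ∃ c, c = 1 + (∑' n, φ (n + 1) + 1) / ψ (q 1) := ⟨_, rfl⟩
  have hc1 : 1 ≤ c := by
    rw [hc]
    have : 0 ≤ (∑' n, φ (n + 1) + 1) / ψ (q 1) := by positivity
    linarith
  have hp : 0 ≤ 3 / 2 + ε := by linarith
  filter_upwards [hmain] with x ⟨K, hK0, hK⟩
  refine ⟨(K + 6) * (c ^ (1 / 2 : ℝ) * (Real.log c / Real.log 2 + 1) ^ (3 / 2 + ε)), fun N => ?_⟩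
  rcases Nat.eq_zero_or_pos N with rfl | hN
  · rw [countR_sub_zero]
    have : sumPsi q ψ 0 = 0 := by simp [sumPsi]
    rw [this, Real.zero_rpow (by norm_num)]
    simp
  have hΨ := le_sumPsi (q := q) hψ hN
  have hΦN0 : 0 ≤ Φ N := by rw [← hΦ0]; exact hΦmono (Nat.zero_le N)
  obtain ⟨j, hj⟩ : ∃ j, j = ⌊Φ N⌋₊ := ⟨_, rfl⟩
  have hj1 : (j : ℝ) ≤ Φ N := hj ▸ Nat.floor_le hΦN0
  have hj2 : Φ N < j + 1 := hj ▸ Nat.lt_floor_add_one _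
  have htN : t j ≤ N := ht2 j N hj1
  have hNt : N ≤ t (j + 1) := by
    by_contra h
    have h1 := hΦmono (not_le.1 h).le
    have h2 := ht1 (j + 1)
    push_cast at h2
    linarith
  simp only [ht0, Finset.Ioc_self, Finset.sum_empty, sub_zero, ← countR_sub_eq_sum] at hK
  have hg : ∀ i : ℕ, i ≤ j + 1 → |(countR q γ ψ x (t i) : ℝ) - 2 * sumPsi q ψ (t i)| ≤
      K * (((j + 1 : ℕ) : ℝ) ^ (1 / 2 : ℝ) *
        Real.log (((j + 1 : ℕ) : ℝ) + 2) ^ (3 / 2 + ε)) := by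
    intro i hi
    rcases Nat.eq_zero_or_pos i with rfl | hi0
    · rw [ht0, countR_sub_zero, abs_zero]
      have : 0 ≤ Real.log (((j + 1 : ℕ) : ℝ) + 2) :=
        Real.log_nonneg (by push_cast; linarith [(Nat.cast_nonneg j : (0 : ℝ) ≤ j)])
      positivity
    · refine (hK i hi0).trans ?_
      have h1 : (i : ℝ) ≤ ((j + 1 : ℕ) : ℝ) := by exact_mod_cast hi
      have h0 : (0 : ℝ) ≤ i := by positivity
      have h2 : 0 ≤ Real.log ((i : ℝ) + 2) := Real.log_nonneg (by linarith)
      gcongr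
  have hu := (abs_le.1 (hg (j + 1) le_rfl)).2
  have hl := (abs_le.1 (hg j (Nat.le_succ j))).1
  have hmu : (countR q γ ψ x N : ℝ) ≤ countR q γ ψ x (t (j + 1)) := by
    exact_mod_cast countR_mono q γ ψ x hNt
  have hml : (countR q γ ψ x (t j) : ℝ) ≤ countR q γ ψ x N := by
    exact_mod_cast countR_mono q γ ψ x htN
  have hsu := hψΦ _ _ hNt
  have hsl := hψΦ _ _ htN
  have htu := htle (j + 1)
  have htl := ht1 j
  push_cast at htu
  -- The count is monotone and `t j ≤ N ≤ t (j + 1)`. Between these times `Φ` grows from at least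
  -- `j` to at most `j + 3`, so `2 * sumPsi` moves by at most `6`.
  have hstep : |(countR q γ ψ x N : ℝ) - 2 * sumPsi q ψ N| ≤
      K * (((j + 1 : ℕ) : ℝ) ^ (1 / 2 : ℝ) *
        Real.log (((j + 1 : ℕ) : ℝ) + 2) ^ (3 / 2 + ε)) + 6 := by
    rw [abs_le]
    constructor <;> linarith
  have hone : 1 ≤ ((j + 1 : ℕ) : ℝ) ^ (1 / 2 : ℝ) *
      Real.log (((j + 1 : ℕ) : ℝ) + 2) ^ (3 / 2 + ε) := by
    have h1 : (1 : ℝ) ≤ ((j + 1 : ℕ) : ℝ) := by exact_mod_cast Nat.le_add_left 1 j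
    refine one_le_mul_of_one_le_of_one_le (Real.one_le_rpow h1 (by norm_num))
      (Real.one_le_rpow ?_ hp)
    rw [Real.le_log_iff_exp_le (by linarith)]
    linarith [Real.exp_one_lt_d9]
  have hjc : ((j + 1 : ℕ) : ℝ) ≤ c * sumPsi q ψ N := by
    have h1 : (∑' n, φ (n + 1) + 1) ≤ (∑' n, φ (n + 1) + 1) / ψ (q 1) * sumPsi q ψ N := by
      rw [div_mul_eq_mul_div, le_div_iff₀ hψ1]
      gcongr
    have h2 := hφT N
    have h3 := hφΦ N
    rw [hc, add_mul, one_mul]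
    push_cast
    linarith
  have hfin := rpow_mul_log_rpow_le hc1 hp (hψ1.le.trans hΨ) (by positivity) hjc
  calc _ ≤ _ := hstep
    _ ≤ (K + 6) * (((j + 1 : ℕ) : ℝ) ^ (1 / 2 : ℝ) *
        Real.log (((j + 1 : ℕ) : ℝ) + 2) ^ (3 / 2 + ε)) := by linarith
    _ ≤ (K + 6) * (c ^ (1 / 2 : ℝ) * (Real.log c / Real.log 2 + 1) ^ (3 / 2 + ε) *
        (sumPsi q ψ N ^ (1 / 2 : ℝ) * Real.log (sumPsi q ψ N + 2) ^ (3 / 2 + ε))) :=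
      mul_le_mul_of_nonneg_left hfin (by linarith)
    _ = _ := by ring

theorem theorem1p8
    (q : ℕ → ℝ) (hq : IsLacunary q)
    (γ : ℝ) (hγ : γ ∈ Set.Icc (0 : ℝ) 1)
    (ψ : ℝ → ℝ) (hψ : ∀ t, ψ t ∈ Set.Ioo (0 : ℝ) 1)
    (hψ_half : ∀ n : ℕ, 1 ≤ n → ψ (q n) ≤ 1 / 2)
    (E : Set ℝ) (hE : E ⊆ Set.Icc (0 : ℝ) 1)
    (μ : Measure ℝ) [IsProbabilityMeasure μ] (hμE : μ Eᶜ = 0)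
    (hdecay : ∃ A : ℝ, 2 < A ∧
      Asymptotics.IsBigO (cocompact ℝ) (measureFourier μ) (fun t => Real.log |t| ^ (-A)))
    (ε : ℝ) (hε : 0 < ε) :
    ∀ᵐ x ∂μ, x ∈ E → ∃ K : ℝ, ∀ N : ℕ,
      |(countR q γ ψ x N : ℝ) - 2 * sumPsi q ψ N| ≤
        K * (sumPsi q ψ N ^ (1 / 2 : ℝ) *
          Real.log (sumPsi q ψ N + 2) ^ (3 / 2 + ε)) := by
  obtain ⟨φ, B, hφ, hB, hφ1, hμ, hvar⟩ := exists_variance_le hq γ hψ hψ_half μ hdecay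
  have h : ∀ᵐ x ∂μ, ∃ K : ℝ, ∀ N : ℕ, |(countR q γ ψ x N : ℝ) - 2 * sumPsi q ψ N| ≤
      K * (sumPsi q ψ N ^ (1 / 2 : ℝ) * Real.log (sumPsi q ψ N + 2) ^ (3 / 2 + ε)) := by
    by_cases hM : ∃ M, ∀ N, sumPsi q ψ N ≤ M
    · obtain ⟨M, hM⟩ := hM
      exact ae_exists_countR_le_of_bddAbove hψ hφ hμ hM (by linarith)
    · push Not at hM
      exact ae_exists_countR_le_of_not_bddAbove hψ hB hφ hφ1 hvar
        (fun M => (hM M).imp fun N hN => hN.le) hε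
  filter_upwards [h] with x hx _ using hx
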